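/- **Theorem.** There are a single real-RAM program $A$ and absolute constants $C,e\in\mathbb N$ and $c>0$ such that the following holds for all integers $d\ge 1$ and $k\ge 0$ and every set $P$ of $k$ distinct points in $\mathbb{R}^d$. Given $d$, $k$ and the coordinates of the points of $P$, listed in any order, the program $A$ halts after at most $C\,(d+k)^e$ steps and outputs the coefficients $(a_1,\dots,a_d,b)$, $(a_1,\dots,a_d)\neq 0$, of a hyperplane $h=\{x\in\mathbb{R}^d : a_1x_1+\dots+a_dx_d=b\}$, and if $k\ge 3$, then $$|P\cap h|\;\ge\; c\cdot\frac{\mathrm{OPT}\cdot\log k}{k\,\log\log k},$$ where $\mathrm{OPT}$ is the maximum of $|P\cap h'|$ over all hyperplanes $h'$ of $\mathbb{R}^d$. Here a hyperplane is a $(d-1)$-dimensional affine subspace of $\mathbb{R}^d$. A real-RAM program is a finite program with conditionals and while-loops over finitely many natural-number and real variables and arrays with indirect addressing. Each instruction and each test costs one step. The instructions are: rational real constants and exact $+,-,\cdot,/$ on reals (no rounding; division by zero is not allowed); natural-number constants, addition and truncated subtraction on natural numbers; and copying, loading and storing. The tests are $<$ and $=$ between two naturals or two reals. -/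

import Mathlib

/-! ### A real RAM

Programs work on natural-number variables and arrays and on real variables and arrays.  All
variables and arrays of a program are named by literals, so a program uses only finitely many of
them; array cells are reached by computed indices (indirect addressing).  One unit of time is
charged for each instruction and for each evaluation of a test.  Real numbers are handled exactly,
by `+`, `-`, `*`, `/` and comparisons; there is no rounding, and no way to turn a real number into
an integer other than comparing it.  Natural numbers support only addition, (truncated) subtraction
and comparisons, so that their bit length grows by at most one per step. -/

namespace RealRAM

/-- The contents of the memory: natural-number variables, natural-number arrays, real variables and
real arrays. -/
structure State where
  ivar : ℕ → ℕ
  iarr : ℕ → ℕ → ℕ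
  rvar : ℕ → ℝ
  rarr : ℕ → ℕ → ℝ

/-- The instructions; their effect is given by `Instr.run`. -/
inductive Instr where
  | iconst (x n : ℕ)
  | imove (x y : ℕ)
  | iadd (x y z : ℕ)
  | isub (x y z : ℕ)
  | iload (x a y : ℕ)
  | istore (a y x : ℕ)
  | rconst (x : ℕ) (q : ℚ)
  | rmove (x y : ℕ)
  | radd (x y z : ℕ)
  | rsub (x y z : ℕ)
  | rmul (x y z : ℕ)
  | rdiv (x y z : ℕ)
  | rload (x a y : ℕ)
  | rstore (a y x : ℕ)

/-- Assign a value to a natural-number variable. -/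
def State.setI (s : State) (x v : ℕ) : State :=
  { s with ivar := Function.update s.ivar x v }

/-- Assign a value to a cell of a natural-number array. -/
def State.setIArr (s : State) (a i v : ℕ) : State :=
  { s with iarr := Function.update s.iarr a (Function.update (s.iarr a) i v) }

/-- Assign a value to a real variable. -/
def State.setR (s : State) (x : ℕ) (v : ℝ) : State :=
  { s with rvar := Function.update s.rvar x v }

/-- Assign a value to a cell of a real array. -/
def State.setRArr (s : State) (a i : ℕ) (v : ℝ) : State :=
  { s with rarr := Function.update s.rarr a (Function.update (s.rarr a) i v) }

/-- The effect of one instruction.  A division by zero has no successor state: the machine gets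
stuck. -/
noncomputable def Instr.run : Instr → State → Option State
  | .iconst x n, s => some (s.setI x n)
  | .imove x y, s => some (s.setI x (s.ivar y))
  | .iadd x y z, s => some (s.setI x (s.ivar y + s.ivar z))
  | .isub x y z, s => some (s.setI x (s.ivar y - s.ivar z))
  | .iload x a y, s => some (s.setI x (s.iarr a (s.ivar y)))
  | .istore a y x, s => some (s.setIArr a (s.ivar y) (s.ivar x))
  | .rconst x q, s => some (s.setR x (q : ℝ))
  | .rmove x y, s => some (s.setR x (s.rvar y))
  | .radd x y z, s => some (s.setR x (s.rvar y + s.rvar z))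
  | .rsub x y z, s => some (s.setR x (s.rvar y - s.rvar z))
  | .rmul x y z, s => some (s.setR x (s.rvar y * s.rvar z))
  | .rdiv x y z, s => if s.rvar z = 0 then none else some (s.setR x (s.rvar y / s.rvar z))
  | .rload x a y, s => some (s.setR x (s.rarr a (s.ivar y)))
  | .rstore a y x, s => some (s.setRArr a (s.ivar y) (s.rvar x))

/-- The tests: comparisons of two natural-number variables or of two real variables. -/
inductive Test where
  | ilt (x y : ℕ)
  | ieq (x y : ℕ)
  | rlt (x y : ℕ)
  | req (x y : ℕ)

/-- When a test succeeds. -/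
def Test.Holds : Test → State → Prop
  | .ilt x y, s => s.ivar x < s.ivar y
  | .ieq x y, s => s.ivar x = s.ivar y
  | .rlt x y, s => s.rvar x < s.rvar y
  | .req x y, s => s.rvar x = s.rvar y

/-- Programs. -/
inductive Prog where
  | skip : Prog
  | instr : Instr → Prog
  | seq : Prog → Prog → Prog
  | ifElse : Test → Prog → Prog → Prog
  | loop : Test → Prog → Prog

/-- `Exec p s t s'`: the program `p`, started in `s`, halts in `s'` after exactly `t` units of time.
The program `loop b p` repeats `p` while the test `b` succeeds. -/
inductive Exec : Prog → State → ℕ → State → Prop where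
  | skip (s : State) : Exec .skip s 1 s
  | instr {c : Instr} {s s' : State} (h : c.run s = some s') : Exec (.instr c) s 1 s'
  | seq {p q : Prog} {s s' s'' : State} {t t' : ℕ}
      (hp : Exec p s t s') (hq : Exec q s' t' s'') : Exec (.seq p q) s (t + t') s''
  | ifTrue {b : Test} {p q : Prog} {s s' : State} {t : ℕ}
      (hb : b.Holds s) (hp : Exec p s t s') : Exec (.ifElse b p q) s (1 + t) s'
  | ifFalse {b : Test} {p q : Prog} {s s' : State} {t : ℕ}
      (hb : ¬ b.Holds s) (hq : Exec q s t s') : Exec (.ifElse b p q) s (1 + t) s'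
  | loopTrue {b : Test} {p : Prog} {s s' s'' : State} {t t' : ℕ}
      (hb : b.Holds s) (hp : Exec p s t s') (hl : Exec (.loop b p) s' t' s'') :
      Exec (.loop b p) s (1 + t + t') s''
  | loopFalse {b : Test} {p : Prog} {s : State} (hb : ¬ b.Holds s) : Exec (.loop b p) s 1 s

/-- The initial state for `k` points `P 0, …, P (k - 1)` in `ℝ^d`: natural-number variables `0` and
`1` hold `d` and `k`, cell `i * d + j` of real array `0` holds coordinate `j` of point `i`, and
everything else is zero. -/
noncomputable def input {d k : ℕ} (P : Fin k → EuclideanSpace ℝ (Fin d)) : State where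
  ivar x := if x = 0 then d else if x = 1 then k else 0
  iarr _ _ := 0
  rvar _ := 0
  rarr a n :=
    if h : a = 0 ∧ n / d < k ∧ 0 < d then P ⟨n / d, h.2.1⟩ ⟨n % d, Nat.mod_lt n h.2.2⟩ else 0

/-- In the state `s`, the real array `1` holds a description of the affine subspace `h` of `ℝ^d` by
one linear equation: `h = {x | a_0 x_0 + ⋯ + a_(d-1) x_(d-1) = a_d}`, where `a_j` is cell `j`. -/
def Outputs {d : ℕ} (s : State) (h : AffineSubspace ℝ (EuclideanSpace ℝ (Fin d))) : Prop :=
  ∀ x : EuclideanSpace ℝ (Fin d), x ∈ h ↔ ∑ j : Fin d, s.rarr 1 (j : ℕ) * x j = s.rarr 1 d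

end RealRAM

/-- A hyperplane of `ℝ^d`: a nonempty affine subspace of dimension `d - 1`. -/
def IsHyperplane {d : ℕ} (h : AffineSubspace ℝ (EuclideanSpace ℝ (Fin d))) : Prop :=
  (h : Set (EuclideanSpace ℝ (Fin d))).Nonempty ∧ Module.finrank ℝ h.direction + 1 = d

/-- The number of points of `P` on `h`. -/
noncomputable def numOn {d : ℕ} (P : Set (EuclideanSpace ℝ (Fin d)))
    (h : AffineSubspace ℝ (EuclideanSpace ℝ (Fin d))) : ℕ :=
  (P ∩ (h : Set (EuclideanSpace ℝ (Fin d)))).ncard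

/-- The maximum number of points of the (finite) set `P` on a single hyperplane. -/
noncomputable def maxOnHyperplane {d : ℕ} (P : Set (EuclideanSpace ℝ (Fin d))) : ℕ :=
  sSup {n : ℕ | ∃ h : AffineSubspace ℝ (EuclideanSpace ℝ (Fin d)), IsHyperplane h ∧ numOn P h = n}

/-!
A point `x` of `ℝ^d` is replaced by the vector `(x, -1)` of `ℝ^(d+1)`, and the hyperplane
`a ⬝ x = b` by the vector `(a, b)`; the point lies on the hyperplane if and only if the two vectors
are orthogonal.  So a nonempty set of points lies on a hyperplane if and only if the projection onto
the orthogonal complement of its vectors is not zero, and then every nonzero row of the matrix of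
the projection gives such a hyperplane.

The program splits the points into blocks of about `log₂ k` points and treats all subsets of each
block.  A block has at most `2 k` subsets, so this takes polynomial time.  If a hyperplane contains
`OPT` points, then one of the `O(k / log k)` blocks has `Ω(OPT * log k / k)` points on it; these
points form one of the subsets treated, so the best hyperplane found contains at least as many.
This is better than required by a factor of `log log k`.

The subsets of the current block are kept in a list, together with the matrices of their
projections.  A new point doubles the list: from each subset, one Gram-Schmidt step
(`IsAnnihilatorProj.insert`) makes the subset that also contains the new point.  Once the list has
at least `k` members, it is cut down to the empty set and a new block starts, so the program never
has to compute a logarithm.  What is known after each point is `BlockInv`; it is preserved by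
`BlockInv.step` and `BlockInv.reset`, and `ratio_le` derives the approximation ratio from it.

Correctness of the program is proved by a small program logic.  `Runs` asserts termination within
the time `Prog.cost N`, the time needed when no loop makes more than `N` iterations.  For a fixed
program this is a polynomial in `N` (`Prog.exists_cost_le`), so it is enough to bound the number of
iterations of each loop, by `d + k + 1`.
-/

/-! ### Projections that annihilate a set of vectors -/

open Matrix in
/-- One step of the Gram-Schmidt process, for projection matrices: with `w = M v`, the part of `M`
in the direction of `w` is removed. -/
noncomputable def projStep {D : ℕ} (M : Matrix (Fin D) (Fin D) ℝ) (v : Fin D → ℝ) :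
    Matrix (Fin D) (Fin D) ℝ :=
  .of fun r c => M r c - (M *ᵥ v) r * (M *ᵥ v) c / ((M *ᵥ v) ⬝ᵥ (M *ᵥ v))

open Matrix in
/-- `M` is the matrix of the orthogonal projection onto the orthogonal complement of `S`. -/
structure IsAnnihilatorProj {D : ℕ} (M : Matrix (Fin D) (Fin D) ℝ) (S : Set (Fin D → ℝ)) :
    Prop where
  symm : Mᵀ = M
  idem : M * M = M
  zero : ∀ v ∈ S, M *ᵥ v = 0
  fixed : ∀ x, (∀ v ∈ S, v ⬝ᵥ x = 0) → M *ᵥ x = x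

namespace IsAnnihilatorProj
open Matrix
variable {D : ℕ} {M : Matrix (Fin D) (Fin D) ℝ} {S : Set (Fin D → ℝ)}

theorem one_empty : IsAnnihilatorProj (1 : Matrix (Fin D) (Fin D) ℝ) ∅ :=
  ⟨by simp, by simp, by simp, by simp⟩

/-- The vector `v` is added to the set that the projection annihilates.  If `v` already lies in the
span of the set, then `M *ᵥ v = 0` and the quotient is `0 / 0 = 0`. -/
theorem insert (h : IsAnnihilatorProj M S) (v : Fin D → ℝ) :
    IsAnnihilatorProj (projStep M v) (insert v S) := by
  unfold projStep
  set w := M *ᵥ v with hw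
  set q := w ⬝ᵥ w with hq
  have hM : (.of fun r c => M r c - w r * w c / q : Matrix (Fin D) (Fin D) ℝ)
      = M - q⁻¹ • vecMulVec w w := by
    ext r c
    simp only [of_apply, Matrix.sub_apply, Matrix.smul_apply, vecMulVec_apply, smul_eq_mul]
    ring
  have hMw : M *ᵥ w = w := by rw [hw, mulVec_mulVec, h.idem]
  have hwM : w ᵥ* M = w := by rw [← mulVec_transpose, h.symm, hMw]
  have hdot : ∀ x, w ⬝ᵥ x = v ⬝ᵥ (M *ᵥ x) := fun x => by
    rw [dotProduct_mulVec, hw, ← mulVec_transpose, h.symm]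
  have hqw : (q⁻¹ * q) • w = w := by
    by_cases h0 : q = 0
    · rw [dotProduct_self_eq_zero.1 h0, smul_zero]
    · rw [inv_mul_cancel₀ h0, one_smul]
  have happ : ∀ x, (M - q⁻¹ • vecMulVec w w) *ᵥ x = M *ᵥ x - (q⁻¹ * (w ⬝ᵥ x)) • w := fun x => by
    rw [sub_mulVec, smul_mulVec, vecMulVec_mulVec]
    ext r
    simp
    ring
  rw [hM]
  refine ⟨?_, ?_, ?_, ?_⟩
  · rw [transpose_sub, transpose_smul, transpose_vecMulVec, h.symm]
  · have e1 : M * vecMulVec w w = vecMulVec w w := by rw [mul_vecMulVec, hMw]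
    have e2 : vecMulVec w w * M = vecMulVec w w := by rw [vecMulVec_mul, hwM]
    have e3 : q⁻¹ • q⁻¹ • (vecMulVec w w * vecMulVec w w) = q⁻¹ • vecMulVec w w := by
      rw [vecMulVec_mul_vecMulVec, ← hq, vecMulVec_smul, ← smul_vecMulVec, ← smul_vecMulVec,
        ← smul_vecMulVec, smul_smul q⁻¹ q w, hqw, smul_vecMulVec]
    rw [sub_mul, mul_sub, mul_sub, h.idem, mul_smul_comm, smul_mul_assoc, smul_mul_smul_comm, e1,
      e2, ← smul_smul, e3]
    abel
  · intro u hu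
    rw [happ]
    rcases Set.mem_insert_iff.1 hu with rfl | hu
    · have : w ⬝ᵥ u = q := by rw [hq, hdot w, hMw, dotProduct_comm]
      rw [this, hqw, sub_self]
    · rw [hdot, h.zero u hu]
      simp
  · intro x hx
    have h1 := h.fixed x fun u hu => hx u (Set.mem_insert_of_mem _ hu)
    rw [happ, hdot, h1, hx v (Set.mem_insert _ _)]
    simp

/-- The rows of the projection are orthogonal to `S`. -/
theorem row_dotProduct (h : IsAnnihilatorProj M S) {v : Fin D → ℝ} (hv : v ∈ S) (r : Fin D) :
    M r ⬝ᵥ v = 0 := congrFun (h.zero v hv) r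

/-- A nonzero vector orthogonal to `S` forces a nonzero diagonal entry, because a diagonal entry of
a projection is the squared length of its row. -/
theorem exists_diag_ne_zero (h : IsAnnihilatorProj M S) {x : Fin D → ℝ} (hx : x ≠ 0)
    (hS : ∀ v ∈ S, v ⬝ᵥ x = 0) : ∃ r, M r r ≠ 0 := by
  by_contra! hd
  refine hx ?_
  rw [← h.fixed x hS]
  have hrow : ∀ r, M r = 0 := fun r => by
    rw [← dotProduct_self_eq_zero, ← hd r]
    conv_rhs => rw [← h.idem]
    rw [mul_apply]
    refine Finset.sum_congr rfl fun c _ => ?_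
    rw [← congrFun (congrFun h.symm c) r, transpose_apply]
  ext r
  rw [mulVec, hrow r, zero_dotProduct, Pi.zero_apply]

end IsAnnihilatorProj

/-! ### Hyperplanes and linear equations -/

section
variable {d : ℕ}

theorem IsHyperplane.exists_equation {h : AffineSubspace ℝ (EuclideanSpace ℝ (Fin d))}
    (hh : IsHyperplane h) : ∃ (a : Fin d → ℝ) (b : ℝ), a ≠ 0 ∧ ∀ x ∈ h, ∑ j, a j * x j = b := by
  obtain ⟨⟨p, hp⟩, hfin⟩ := hh
  have hdir : h.directionᗮ ≠ ⊥ := fun hb => by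
    rw [Submodule.orthogonal_eq_bot_iff] at hb
    rw [hb, finrank_top, finrank_euclideanSpace_fin] at hfin
    omega
  obtain ⟨a, ha, ha0⟩ := Submodule.exists_mem_ne_zero_of_ne_bot hdir
  refine ⟨a, ∑ j, a j * p j, fun h0 => ha0 (by ext j; exact congrFun h0 j), fun x hx => ?_⟩
  have := (Submodule.mem_orthogonal' _ _).1 ha _ (AffineSubspace.vsub_mem_direction hx hp)
  rw [← sub_eq_zero, ← Finset.sum_sub_distrib]
  simpa [PiLp.inner_apply, sub_mul, mul_comm (a _)] using this

theorem exists_isHyperplane_of_equation {a : Fin d → ℝ} (ha : a ≠ 0) (b : ℝ) :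
    ∃ h : AffineSubspace ℝ (EuclideanSpace ℝ (Fin d)), IsHyperplane h ∧
      ∀ x, x ∈ h ↔ ∑ j, a j * x j = b := by
  let f : EuclideanSpace ℝ (Fin d) →ₗ[ℝ] ℝ := 
    ∑ j, a j • (EuclideanSpace.proj j : EuclideanSpace ℝ (Fin d) →L[ℝ] ℝ).toLinearMap
  have hf : ∀ x, f x = ∑ j, a j * x j := fun x => by simp [f]
  obtain ⟨j₀, hj₀⟩ := Function.ne_iff.1 ha
  have hne : f ≠ 0 := fun h0 => hj₀ <| by
    have := hf (EuclideanSpace.single j₀ 1)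
    simpa [h0] using this.symm
  obtain ⟨p, hp⟩ := LinearMap.surjective hne b
  refine ⟨AffineSubspace.mk' p (LinearMap.ker f),
    ⟨⟨p, AffineSubspace.self_mem_mk' _ _⟩, ?_⟩, fun x => ?_⟩
  · rw [AffineSubspace.direction_mk']
    have h1 := LinearMap.finrank_range_add_finrank_ker f
    rw [LinearMap.range_eq_top.2 (LinearMap.surjective hne), finrank_top,
      finrank_euclideanSpace_fin, Module.finrank_self] at h1
    omega
  · rw [AffineSubspace.mem_mk', LinearMap.mem_ker, vsub_eq_sub, map_sub, hp, sub_eq_zero, hf]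

end

/-! ### The combinatorial invariant -/

section
open Matrix

/-- Subset number `j` in the list is `S`: matrix `j` is the projection that annihilates the vectors
with indices in `S`, and cell `j` of `cnt` is the size of `S`. -/
structure Represents {D : ℕ} (v : ℕ → Fin D → ℝ) (M : ℕ → Matrix (Fin D) (Fin D) ℝ) (cnt : ℕ → ℕ)
    (j : ℕ) (S : Finset ℕ) : Prop where
  proj : IsAnnihilatorProj (M j) (v '' S)
  count : cnt j = S.card

/-- The vector `out`, whose last entry is the right-hand side of an equation and whose other entries
are its coefficients, describes a hyperplane with at least `best` of the points
`0, …, n - 1`. -/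
structure IsWitness {d : ℕ} (v : ℕ → Fin (d + 1) → ℝ) (n best : ℕ) (out : Fin (d + 1) → ℝ) :
    Prop where
  ne_zero : ∃ j : Fin d, out j.castSucc ≠ 0
  exists_subset : ∃ S ⊆ Finset.range n, S.card = best ∧ ∀ t ∈ S, out ⬝ᵥ v t = 0

theorem IsWitness.mono {d n n' best : ℕ} {v : ℕ → Fin (d + 1) → ℝ} {out : Fin (d + 1) → ℝ}
    (h : IsWitness v n best out) (hn : n ≤ n') : IsWitness v n' best out := by
  obtain ⟨h0, S, hS, h⟩ := h
  exact ⟨h0, S, hS.trans (Finset.range_subset_range.2 hn), h⟩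

/-- A nonzero row of a projection that annihilates vectors with last coordinate `-1` describes a
hyperplane: if only its last entry were nonzero, it would not be orthogonal to these vectors. -/
theorem isWitness_row {d n j : ℕ} {v : ℕ → Fin (d + 1) → ℝ} (hv : ∀ t, v t (Fin.last d) = -1)
    {M : ℕ → Matrix (Fin (d + 1)) (Fin (d + 1)) ℝ} {cnt : ℕ → ℕ} {S : Finset ℕ}
    (h : Represents v M cnt j S) (hS : S ⊆ Finset.range n) (hne : S.Nonempty) {r : Fin (d + 1)}
    (hr : M j r r ≠ 0) : IsWitness v n S.card (M j r) := by
  have hdot : ∀ t ∈ S, M j r ⬝ᵥ v t = 0 := fun t ht =>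
    h.proj.row_dotProduct (Set.mem_image_of_mem _ ht) r
  refine ⟨?_, S, hS, rfl, hdot⟩
  by_contra! h0
  obtain ⟨t, ht⟩ := hne
  -- the last coordinate of `v t` is `-1`, so the last entry of the row is zero as well
  have h1 := hdot t ht
  rw [dotProduct, Fin.sum_univ_castSucc, Finset.sum_eq_zero fun c _ => by rw [h0 c, zero_mul], hv]
    at h1
  have hlast : M j r (Fin.last d) = 0 := by linarith
  induction r using Fin.lastCases with
  | last => exact hr hlast
  | cast c => exact hr (h0 c)

/-- The number of indices in `S` whose vector is orthogonal to `x`. -/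
noncomputable def orthCount {D : ℕ} (v : ℕ → Fin D → ℝ) (S : Finset ℕ) (x : Fin D → ℝ) : ℕ :=
  {t ∈ S | v t ⬝ᵥ x = 0}.card

/-- What is known when the points `0, …, m - 1` have been processed.  The points
`start, …, m - 1` form the current block; there have been `nb` blocks before, each of at least
`log k` points.  There are `L` subsets in the list, all those of the current block. -/
structure BlockInv {d : ℕ} (v : ℕ → Fin (d + 1) → ℝ) (k m start nb : ℕ) (sub : ℕ → Finset ℕ)
    (L best : ℕ) (cnt : ℕ → ℕ) (M : ℕ → Matrix (Fin (d + 1)) (Fin (d + 1)) ℝ)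
    (out : Fin (d + 1) → ℝ) : Prop where
  start_le : start ≤ m
  length : L = 2 ^ (m - start)
  blocks : nb * Real.log k ≤ start
  empty : Represents v M cnt 0 ∅
  represents : ∀ j < L, Represents v M cnt j (sub j)
  sub_subset : ∀ j < L, sub j ⊆ Finset.range m
  exists_sub : ∀ S ⊆ Finset.Ico start m, ∃ j < L, sub j = S
  old_le : ∀ x ≠ 0, orthCount v (Finset.range start) x ≤ nb * best
  new_le : ∀ x ≠ 0, orthCount v (Finset.Ico start m) x ≤ best
  witness : IsWitness v m best out

namespace BlockInv
variable {d : ℕ} {v : ℕ → Fin (d + 1) → ℝ} {k m start nb : ℕ} {sub : ℕ → Finset ℕ}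
  {L best : ℕ} {cnt : ℕ → ℕ} {M : ℕ → Matrix (Fin (d + 1)) (Fin (d + 1)) ℝ}
  {out : Fin (d + 1) → ℝ}

theorem orthCount_range_le (h : BlockInv v k m start nb sub L best cnt M out) {x : Fin (d + 1) → ℝ}
    (hx : x ≠ 0) : orthCount v (Finset.range m) x ≤ (nb + 1) * best := by
  have hunion : Finset.range m = Finset.range start ∪ Finset.Ico start m := by
    ext t
    have := h.start_le
    simp only [Finset.mem_range, Finset.mem_union, Finset.mem_Ico]
    omega
  calc orthCount v (Finset.range m) x
      ≤ orthCount v (Finset.range start) x + orthCount v (Finset.Ico start m) x := by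
        rw [orthCount, hunion, Finset.filter_union]
        exact Finset.card_union_le _ _
    _ ≤ nb * best + best := add_le_add (h.old_le x hx) (h.new_le x hx)
    _ = _ := by ring

/-- A new block is started once the list has at least `k` subsets. -/
theorem reset (h : BlockInv v k m start nb sub L best cnt M out) (hk : k ≤ L) :
    BlockInv v k m m (nb + 1) (fun _ => ∅) 1 best cnt M out where
  start_le := le_rfl
  length := by simp
  blocks := by
    have h1 : Real.log k ≤ m - start := by
      rcases Nat.eq_zero_or_pos k with rfl | hk0
      · simpa using h.start_le
      · rw [← Nat.cast_sub h.start_le]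
        calc Real.log k ≤ Real.log (2 ^ (m - start) : ℝ) := by
              refine Real.log_le_log (by exact_mod_cast hk0) ?_
              have := h.length
              exact_mod_cast this ▸ hk
          _ = (m - start : ℕ) * Real.log 2 := by rw [Real.log_pow]
          _ ≤ (m - start : ℕ) * 1 := by
              gcongr
              linarith [Real.log_two_lt_d9]
          _ = _ := mul_one _
    have h2 := h.blocks
    push_cast
    linarith
  empty := h.empty
  represents := fun j hj => by
    obtain rfl : j = 0 := by omega
    exact h.empty
  sub_subset := by simp
  exists_sub := fun S hS => ⟨0, by simp, (by simpa using hS : S = ∅).symm⟩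
  old_le := fun x hx => h.orthCount_range_le hx
  new_le := by simp [orthCount]
  witness := h.witness

/-- One more point is processed: the list is doubled by the subsets that contain the new point. -/
theorem step (h : BlockInv v k m start nb sub L best cnt M out) {best' : ℕ} {cnt' : ℕ → ℕ}
    {M' : ℕ → Matrix (Fin (d + 1)) (Fin (d + 1)) ℝ} {out' : Fin (d + 1) → ℝ}
    (hbest : best ≤ best') (hold : ∀ j < L, M' j = M j ∧ cnt' j = cnt j)
    (hnew : ∀ j < L, Represents v M' cnt' (L + j) (insert m (sub j)))
    (hmax : ∀ j < L, ∀ x ≠ 0, (∀ t ∈ insert m (sub j), v t ⬝ᵥ x = 0) →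
      (insert m (sub j)).card ≤ best')
    (hout : IsWitness v (m + 1) best' out') :
    BlockInv v k (m + 1) start nb (fun j => if j < L then sub j else insert m (sub (j - L)))
      (L + L) best' cnt' M' out' where
  start_le := h.start_le.trans (Nat.le_succ m)
  length := by rw [Nat.succ_sub h.start_le, pow_succ, ← h.length]; ring
  blocks := h.blocks
  empty := by
    have hL : 0 < L := h.length ▸ Nat.two_pow_pos _
    exact ⟨(hold 0 hL).1 ▸ h.empty.proj, (hold 0 hL).2 ▸ h.empty.count⟩
  represents := fun j hj => by
    split_ifs with hjL
    · exact ⟨(hold j hjL).1 ▸ (h.represents j hjL).proj,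
        (hold j hjL).2 ▸ (h.represents j hjL).count⟩
    · simpa [Nat.add_sub_cancel' (not_lt.1 hjL)] using hnew (j - L) (by omega)
  sub_subset := fun j hj => by
    split_ifs with hjL
    · exact (h.sub_subset j hjL).trans (Finset.range_subset_range.2 (Nat.le_succ m))
    · rw [Finset.range_add_one]
      exact Finset.insert_subset_insert _ (h.sub_subset (j - L) (by omega))
  exists_sub := fun S hS => by
    have hsub : S.erase m ⊆ Finset.Ico start m := fun t ht => by
      have h1 := Finset.mem_Ico.1 (hS (Finset.mem_of_mem_erase ht))
      have h2 := Finset.ne_of_mem_erase ht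
      exact Finset.mem_Ico.2 ⟨h1.1, by omega⟩
    obtain ⟨j, hj, hjS⟩ := h.exists_sub _ hsub
    by_cases hm : m ∈ S
    · refine ⟨L + j, by omega, ?_⟩
      simp [hjS, Finset.insert_erase hm]
    · refine ⟨j, by omega, ?_⟩
      simp [hj, hjS, Finset.erase_eq_of_notMem hm]
  old_le := fun x hx => (h.old_le x hx).trans (Nat.mul_le_mul_left _ hbest)
  new_le := fun x hx => by
    have hIco : Finset.Ico start (m + 1) = insert m (Finset.Ico start m) := by
      ext t
      have := h.start_le
      simp only [Finset.mem_insert, Finset.mem_Ico]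
      omega
    by_cases hm : v m ⬝ᵥ x = 0
    · obtain ⟨j, hj, hjS⟩ := h.exists_sub {t ∈ Finset.Ico start m | v t ⬝ᵥ x = 0}
        (Finset.filter_subset _ _)
      have := hmax j hj x hx fun t ht => by
        rw [hjS] at ht
        rcases Finset.mem_insert.1 ht with rfl | ht
        · exact hm
        · exact (Finset.mem_filter.1 ht).2
      rw [orthCount, hIco, Finset.filter_insert, if_pos hm]
      rwa [hjS] at this
    · rw [orthCount, hIco, Finset.filter_insert, if_neg hm]
      exact (h.new_le x hx).trans hbest
  witness := hout

end BlockInv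

end

namespace RealRAM

/-! ### Reasoning about programs -/

/-- An upper bound for the running time of `p` when each of its loops, whenever it is entered,
makes at most `N` iterations. -/
def Prog.cost (N : ℕ) : Prog → ℕ
  | .skip => 1
  | .instr _ => 1
  | .seq p q => p.cost N + q.cost N
  | .ifElse _ p q => 1 + (p.cost N + q.cost N)
  | .loop _ p => N * (1 + p.cost N) + 1

/-- For a fixed program, `Prog.cost` is bounded by a polynomial in the number of iterations. -/
theorem Prog.exists_cost_le (p : Prog) : ∃ C e : ℕ, ∀ N, 1 ≤ N → p.cost N ≤ C * N ^ e := by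
  induction p with
  | skip => exact ⟨1, 0, fun N _ => by simp [cost]⟩
  | instr c => exact ⟨1, 0, fun N _ => by simp [cost]⟩
  | seq p q hp hq =>
    obtain ⟨C, e, h⟩ := hp
    obtain ⟨C', e', h'⟩ := hq
    refine ⟨C + C', e + e', fun N hN => ?_⟩
    have h1 : N ^ e ≤ N ^ (e + e') := Nat.pow_le_pow_right hN (by omega)
    have h2 : N ^ e' ≤ N ^ (e + e') := Nat.pow_le_pow_right hN (by omega)
    calc p.cost N + q.cost N ≤ C * N ^ e + C' * N ^ e' := add_le_add (h N hN) (h' N hN)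
      _ ≤ C * N ^ (e + e') + C' * N ^ (e + e') := by gcongr
      _ = _ := by ring
  | ifElse b p q hp hq =>
    obtain ⟨C, e, h⟩ := hp
    obtain ⟨C', e', h'⟩ := hq
    refine ⟨1 + (C + C'), e + e', fun N hN => ?_⟩
    have h1 : N ^ e ≤ N ^ (e + e') := Nat.pow_le_pow_right hN (by omega)
    have h2 : N ^ e' ≤ N ^ (e + e') := Nat.pow_le_pow_right hN (by omega)
    have h3 : 1 ≤ N ^ (e + e') := Nat.one_le_pow _ _ hN
    calc 1 + (p.cost N + q.cost N) ≤ 1 + (C * N ^ e + C' * N ^ e') := by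
          gcongr
          exacts [h N hN, h' N hN]
      _ ≤ N ^ (e + e') + (C * N ^ (e + e') + C' * N ^ (e + e')) := by gcongr
      _ = _ := by ring
  | loop b p hp =>
    obtain ⟨C, e, h⟩ := hp
    refine ⟨C + 2, e + 1, fun N hN => ?_⟩
    have h1 : N ≤ N ^ (e + 1) := Nat.le_self_pow (by omega) N
    have h3 : 1 ≤ N ^ (e + 1) := Nat.one_le_pow _ _ hN
    calc N * (1 + p.cost N) + 1 ≤ N * (1 + C * N ^ e) + 1 := by
          gcongr
          exact h N hN
      _ = N + C * N ^ (e + 1) + 1 := by ring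
      _ ≤ N ^ (e + 1) + C * N ^ (e + 1) + N ^ (e + 1) := by gcongr
      _ = _ := by ring

/-- The natural-number variables an instruction may change. -/
def Instr.writesI : Instr → ℕ → Bool
  | .iconst x _, y => x == y
  | .imove x _, y => x == y
  | .iadd x _ _, y => x == y
  | .isub x _ _, y => x == y
  | .iload x _ _, y => x == y
  | _, _ => false

/-- The natural-number arrays an instruction may change. -/
def Instr.writesIArr : Instr → ℕ → Bool
  | .istore a _ _, y => a == y
  | _, _ => false

/-- The real variables an instruction may change. -/
def Instr.writesR : Instr → ℕ → Bool
  | .rconst x _, y => x == y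
  | .rmove x _, y => x == y
  | .radd x _ _, y => x == y
  | .rsub x _ _, y => x == y
  | .rmul x _ _, y => x == y
  | .rdiv x _ _, y => x == y
  | .rload x _ _, y => x == y
  | _, _ => false

/-- The real arrays an instruction may change. -/
def Instr.writesRArr : Instr → ℕ → Bool
  | .rstore a _ _, y => a == y
  | _, _ => false

/-- Whether some instruction of a program satisfies `f`. -/
def Prog.anyInstr (f : Instr → Bool) : Prog → Bool
  | .skip => false
  | .instr c => f c
  | .seq p q => p.anyInstr f || q.anyInstr f
  | .ifElse _ p q => p.anyInstr f || q.anyInstr f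
  | .loop _ p => p.anyInstr f

/-- The memory that no instruction of `p` writes to is the same in `s` and in `s'`. -/
structure Frame (p : Prog) (s s' : State) : Prop where
  ivar : ∀ x, p.anyInstr (·.writesI x) = false → s'.ivar x = s.ivar x
  iarr : ∀ a, p.anyInstr (·.writesIArr a) = false → s'.iarr a = s.iarr a
  rvar : ∀ x, p.anyInstr (·.writesR x) = false → s'.rvar x = s.rvar x
  rarr : ∀ a, p.anyInstr (·.writesRArr a) = false → s'.rarr a = s.rarr a

theorem Frame.refl (p : Prog) (s : State) : Frame p s s :=
  ⟨fun _ _ => rfl, fun _ _ => rfl, fun _ _ => rfl, fun _ _ => rfl⟩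

theorem Frame.trans {p : Prog} {s s' s'' : State} (h : Frame p s s') (h' : Frame p s' s'') :
    Frame p s s'' :=
  ⟨fun x hx => (h'.ivar x hx).trans (h.ivar x hx), fun x hx => (h'.iarr x hx).trans (h.iarr x hx),
    fun x hx => (h'.rvar x hx).trans (h.rvar x hx), fun x hx => (h'.rarr x hx).trans (h.rarr x hx)⟩

theorem Frame.mono {p q : Prog} {s s' : State} (h : Frame p s s')
    (hpq : ∀ f, q.anyInstr f = false → p.anyInstr f = false) : Frame q s s' :=
  ⟨fun x hx => h.ivar x (hpq _ hx), fun x hx => h.iarr x (hpq _ hx),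
    fun x hx => h.rvar x (hpq _ hx), fun x hx => h.rarr x (hpq _ hx)⟩

theorem Instr.frame {c : Instr} {s s' : State} (h : c.run s = some s') :
    Frame (.instr c) s s' := by
  cases c <;> simp only [Instr.run, Option.some.injEq, Option.ite_none_left_eq_some] at h <;>
    first
    | subst h
    | (obtain ⟨-, rfl⟩ := h)
  all_goals
    constructor <;> intro x hx <;>
      simp_all [Prog.anyInstr, Instr.writesI, Instr.writesIArr, Instr.writesR, Instr.writesRArr,
        State.setI, State.setIArr, State.setR, State.setRArr, Function.update_apply]
    all_goals exact fun h => absurd h.symm hx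

/-- The frame property: a program changes only memory that one of its instructions writes to. -/
theorem Exec.frame {p : Prog} {s s' : State} {t : ℕ} (h : Exec p s t s') : Frame p s s' := by
  induction h with
  | skip s => exact .refl _ _
  | instr h => exact Instr.frame h
  | seq _ _ hp hq =>
    exact (hp.mono fun f hf => by simp_all [Prog.anyInstr]).trans
      (hq.mono fun f hf => by simp_all [Prog.anyInstr])
  | ifTrue _ _ hp => exact hp.mono fun f hf => by simp_all [Prog.anyInstr]
  | ifFalse _ _ hq => exact hq.mono fun f hf => by simp_all [Prog.anyInstr]
  | loopTrue _ _ _ hp hl => exact (hp.mono fun f hf => by simpa [Prog.anyInstr] using hf).trans hl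
  | loopFalse _ => exact .refl _ _

/-- Total correctness: `p`, started in `s`, halts within time `p.cost N` in a state satisfying
`Q`. -/
def Runs (N : ℕ) (p : Prog) (s : State) (Q : State → Prop) : Prop :=
  ∃ t s', Exec p s t s' ∧ t ≤ p.cost N ∧ Q s'

variable {N : ℕ} {s : State} {Q : State → Prop}

theorem Runs.imp {p : Prog} {Q' : State → Prop} (h : Runs N p s Q)
    (hQ : ∀ s', Frame p s s' → Q s' → Q' s') : Runs N p s Q' := by
  obtain ⟨t, s', he, ht, hq⟩ := h
  exact ⟨t, s', he, ht, hQ s' he.frame hq⟩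

theorem runs_skip (h : Q s) : Runs N .skip s Q := ⟨1, s, .skip s, le_rfl, h⟩

theorem runs_instr {c : Instr} {s' : State} (hc : c.run s = some s') (h : Q s') :
    Runs N (.instr c) s Q := ⟨1, s', .instr hc, le_rfl, h⟩

theorem runs_seq {p q : Prog} (h : Runs N p s fun s' => Runs N q s' Q) :
    Runs N (.seq p q) s Q := by
  obtain ⟨t, s', he, ht, t', s'', he', ht', hq⟩ := h
  exact ⟨t + t', s'', .seq he he', add_le_add ht ht', hq⟩

theorem runs_instr_seq {c : Instr} {q : Prog} {s' : State} (hc : c.run s = some s')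
    (h : Runs N q s' Q) : Runs N (.seq (.instr c) q) s Q := runs_seq (runs_instr hc h)

theorem runs_ifElse {b : Test} {p q : Prog} (hp : b.Holds s → Runs N p s Q)
    (hq : ¬ b.Holds s → Runs N q s Q) : Runs N (.ifElse b p q) s Q := by
  by_cases hb : b.Holds s
  · obtain ⟨t, s', he, ht, h⟩ := hp hb
    exact ⟨1 + t, s', .ifTrue hb he, by simp only [Prog.cost]; omega, h⟩
  · obtain ⟨t, s', he, ht, h⟩ := hq hb
    exact ⟨1 + t, s', .ifFalse hb he, by simp only [Prog.cost]; omega, h⟩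

/-- `for i = 0, …, n - 1 do p`, where `i` and `n` are natural-number variables; variable `16`
holds the increment. -/
def Prog.forTo (i n : ℕ) (p : Prog) : Prog :=
  .seq (.instr (.iconst i 0))
    (.loop (.ilt i n) (.seq p (.seq (.instr (.iconst 16 1)) (.instr (.iadd i i 16)))))

/-- The rule for `for`-loops.  The invariant `J m` must hold before the iteration with counter `m`;
memory not written in the loop is known to be as it was at the start. -/
theorem runs_forTo {i n : ℕ} {p : Prog} (J : ℕ → State → Prop)
    (hN : s.ivar n ≤ N) (hi : i ≠ 16) (hn : (Prog.forTo i n p).anyInstr (·.writesI n) = false)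
    (hip : p.anyInstr (·.writesI i) = false)
    (hJ : ∀ m s₁ x y, J m s₁ → J m ((s₁.setI 16 x).setI i y))
    (h0 : J 0 (s.setI i 0))
    (hstep : ∀ m s₁, m < s.ivar n → Frame (Prog.forTo i n p) s s₁ → s₁.ivar i = m → J m s₁ →
      Runs N p s₁ (J (m + 1))) :
    Runs N (Prog.forTo i n p) s (J (s.ivar n)) := by
  set W := Prog.forTo i n p with hW
  -- `l` is the number of iterations left
  have key : ∀ l m s₁, l + m = s.ivar n → Frame W s s₁ → s₁.ivar i = m → J m s₁ →
      ∃ t s', Exec (.loop (.ilt i n)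
        (.seq p (.seq (.instr (.iconst 16 1)) (.instr (.iadd i i 16))))) s₁ t s' ∧
        t ≤ l * (1 + (p.cost N + 2)) + 1 ∧ J (s.ivar n) s' := by
    intro l
    induction l with
    | zero =>
      intro m s₁ hl hF him hj
      refine ⟨1, s₁, .loopFalse ?_, by omega, ?_⟩
      · have := hF.ivar n hn
        simp only [Test.Holds]; omega
      · rwa [← hl, zero_add]
    | succ l ih =>
      intro m s₁ hl hF him hj
      obtain ⟨t, s₂, he, ht, hj₂⟩ := hstep m s₁ (by omega) hF him hj
      have hi2 : s₂.ivar i = m := (he.frame.ivar i hip).trans him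
      have hstep2 : Exec (.seq p (.seq (.instr (.iconst 16 1)) (.instr (.iadd i i 16)))) s₁
          (t + (1 + 1)) ((s₂.setI 16 1).setI i (m + 1)) := by
        refine .seq he (.seq (s' := s₂.setI 16 1) (.instr rfl) (.instr ?_))
        simp [Instr.run, State.setI, hi, hi2]
      have hF2 : Frame W s ((s₂.setI 16 1).setI i (m + 1)) := by
        refine hF.trans (hstep2.frame.mono fun f hf => ?_)
        simp_all [Prog.forTo, Prog.anyInstr]
      obtain ⟨t', s', he', ht', hj'⟩ := ih (m + 1) ((s₂.setI 16 1).setI i (m + 1)) (by omega) hF2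
        (by simp [State.setI]) (hJ _ _ _ _ hj₂)
      refine ⟨_, s', .loopTrue ?_ hstep2 he', ?_, hj'⟩
      · have := hF.ivar n hn
        simp only [Test.Holds]; omega
      · rw [add_mul, one_mul]; omega
  have hF0 : Frame W s (s.setI i 0) :=
    (Instr.frame (c := .iconst i 0) rfl).mono fun f hf => by
      simp_all [Prog.forTo, Prog.anyInstr]
  obtain ⟨t, s', he, ht, hj⟩ := key (s.ivar n) 0 (s.setI i 0) (by omega) hF0
    (by simp [State.setI]) h0
  refine ⟨1 + t, s', .seq (.instr rfl) he, ?_, hj⟩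
  have : s.ivar n * (1 + (p.cost N + 2)) ≤ N * (1 + (p.cost N + 2)) := Nat.mul_le_mul_right _ hN
  simp only [W, Prog.forTo, Prog.cost]
  norm_num
  omega

/-- `x := y * z + u` for natural-number variables, by repeated addition; the loop counter is
variable `12`. -/
def Prog.mulAdd (x y z u : ℕ) : Prog :=
  .seq (.instr (.imove x u)) (.forTo 12 z (.instr (.iadd x x y)))

theorem runs_mulAdd {x y z u : ℕ} (hN : s.ivar z ≤ N) (hx : x ≠ 12 ∧ x ≠ 16)
    (hy : y ≠ x ∧ y ≠ 12 ∧ y ≠ 16) (hz : z ≠ x ∧ z ≠ 12 ∧ z ≠ 16) :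
    Runs N (.mulAdd x y z u) s fun s' => s'.ivar x = s.ivar y * s.ivar z + s.ivar u := by
  refine runs_instr_seq rfl ?_
  have hz' : (s.setI x (s.ivar u)).ivar z = s.ivar z := by simp [State.setI, hz.1]
  refine (runs_forTo (N := N) (s := s.setI x (s.ivar u))
    (fun m s' => s'.ivar x = s.ivar y * m + s.ivar u) (by omega) (by omega) ?_ ?_ ?_ ?_ ?_).imp
    fun s' _ h => by rw [h, hz']
  · simp [Prog.forTo, Prog.anyInstr, Instr.writesI]; omega
  · simp [Prog.anyInstr, Instr.writesI]; omega
  · intro m s₁ a b h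
    simpa [State.setI, hx.1, hx.2] using h
  · simp [State.setI, hx.1]
  · intro m s₁ _ hF _ h
    refine runs_instr rfl ?_
    have hy' : s₁.ivar y = s.ivar y := by
      rw [hF.ivar y]
      · simp [State.setI, hy.1]
      · simp [Prog.forTo, Prog.anyInstr, Instr.writesI]; omega
    simp only [State.setI, Function.update_self, h, hy']
    ring

end RealRAM

namespace RealRAM

variable {N : ℕ} {s : State}

/-! ### The program -/

/-- Variable `10` becomes the address in real array `4` of the entry `(r, c)` of matrix number `y`;
here `y`, `r` and `c` are the contents of the variables `y`, `6` and `7`, and the matrices have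
side length `D`, the content of variable `2`. -/
def entryAddr (y : ℕ) : Prog := .seq (.mulAdd 9 y 2 6) (.mulAdd 10 9 2 7)

/-- Real array `2` becomes the vector `(x, -1)`, where `x` is the input point whose number is in
variable `4`. -/
def loadPoint : Prog :=
  .seq (.forTo 7 0 (.seq (.mulAdd 9 4 0 7) (.seq (.instr (.rload 1 0 9)) (.instr (.rstore 2 7 1)))))
    (.seq (.instr (.rconst 1 (-1))) (.instr (.rstore 2 0 1)))

/-- Real variable `4` becomes the dot product of row `r` of matrix `j` with real array `2`; here
`r` and `j` are in the variables `6` and `5`. -/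
def rowDot : Prog :=
  .seq (.instr (.rconst 4 0)) (.forTo 7 2
    (.seq (entryAddr 5) (.seq (.instr (.rload 1 4 10)) (.seq (.instr (.rload 2 2 7))
      (.seq (.instr (.rmul 1 1 2)) (.instr (.radd 4 4 1)))))))

/-- Real array `3` becomes the product `w` of matrix `j` and real array `2`, and real variable `3`
becomes the squared length of `w`. -/
def projectPoint : Prog :=
  .seq (.instr (.rconst 3 0)) (.forTo 6 2 (.seq rowDot
    (.seq (.instr (.rstore 3 6 4)) (.seq (.instr (.rmul 1 4 4)) (.instr (.radd 3 3 1))))))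

/-- With `j` in variable `5`, the number `j'` of another matrix in variable `13`, and `q` in real
variable `3`, entry `(r, c)` of matrix `j'` becomes that of matrix `j` minus `w_r * w_c / q`. -/
def writeEntry : Prog :=
  .seq (entryAddr 5) (.seq (.instr (.rload 1 4 10)) (.seq (.instr (.rload 2 3 6))
    (.seq (.instr (.rload 4 3 7)) (.seq (.instr (.rmul 2 2 4)) (.seq (.instr (.rdiv 2 2 3))
      (.seq (.instr (.rsub 1 1 2)) (.seq (entryAddr 13) (.instr (.rstore 4 10 1)))))))))

/-- All entries of matrix `j'` are written. -/
def writeMatrix : Prog := .forTo 6 2 (.forTo 7 2 writeEntry)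

/-- Row `r` of matrix `j'` is copied to the output array. -/
def outputRow : Prog :=
  .forTo 7 2 (.seq (entryAddr 13) (.seq (.instr (.rload 1 4 10)) (.instr (.rstore 1 7 1))))

/-- If the count in variable `11` exceeds the best count so far, which is in variable `8`, and some
diagonal entry of matrix `j'` is nonzero, then the row of such an entry becomes the output. -/
def updateBest : Prog :=
  .forTo 6 2 (.seq (.instr (.imove 7 6)) (.seq (entryAddr 13) (.seq (.instr (.rload 1 4 10))
    (.seq (.instr (.rconst 5 0)) (.ifElse (.req 1 5) .skip
      (.ifElse (.ilt 8 11) (.seq (.instr (.imove 8 11)) outputRow) .skip))))))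

/-- The subset number `j` is extended by the current point; the new subset gets the number `L + j`,
where `L` is in variable `3`.  Cell `j` of natural-number array `0` is the size of subset `j`. -/
def extendSubset : Prog :=
  .seq (.instr (.iadd 13 3 5)) (.seq projectPoint
    (.seq (.seq (.instr (.rconst 5 0)) (.ifElse (.req 3 5) (.instr (.rconst 3 1)) .skip))
      (.seq writeMatrix
        (.seq (.seq (.instr (.iload 11 0 5)) (.seq (.instr (.iadd 11 11 14))
            (.instr (.istore 0 13 11))))
          updateBest))))

/-- The processing of one point: if there are already at least `k` subsets, a new block is started,
in which subset `0`, the empty one, is the only one. -/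
def processPoint : Prog :=
  .seq (.ifElse (.ilt 3 1) .skip (.instr (.iconst 3 1)))
    (.seq loadPoint (.seq (.forTo 5 3 extendSubset) (.instr (.iadd 3 3 3))))

/-- Variable `2` becomes `D = d + 1`, matrix `0` the identity and the output the hyperplane
`x_0 = 0`. -/
def setup : Prog :=
  .seq (.instr (.iconst 14 1)) (.seq (.instr (.iadd 2 0 14)) (.seq (.instr (.rconst 1 1))
    (.seq (.instr (.rstore 1 9 1))
      (.seq (.forTo 6 2 (.seq (.mulAdd 9 6 2 6) (.instr (.rstore 4 9 1))))
        (.instr (.iconst 3 1))))))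

/-- The algorithm.  Natural-number variables: `0` is `d`, `1` is `k`, `2` is `D = d + 1`, `3` is the
number `L` of subsets in the list, `4` the current point, `5` the current subset, `6` and `7` a row
and a column, `8` the best count so far, `9` and `10` addresses, `11` the count for the new subset,
`12` the counter in multiplications, `13` the number of the new subset, `14` the constant one, and
`16` the increment in loops.  Real arrays: `0` is the input, `1` the output, `2` the current vector
`v`, `3` its projection `w`, and `4` holds the matrices. -/
def approxHyperplane : Prog := .seq setup (.forTo 4 1 processPoint)

/-! ### Specifications of the parts of the program -/

/-- Entry `(r, c)` of the matrix number `j` stored in real array `4`; variable `2` holds the side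
length. -/
def State.entry (s : State) (j r c : ℕ) : ℝ :=
  s.rarr 4 ((j * s.ivar 2 + r) * s.ivar 2 + c)

theorem mul_add_inj {D a b a' b' : ℕ} (hb : b < D) (hb' : b' < D) :
    a * D + b = a' * D + b' ↔ a = a' ∧ b = b' := by
  refine ⟨fun h => ?_, fun h => by rw [h.1, h.2]⟩
  have hD : 0 < D := by omega
  have h1 := congrArg (· / D) h
  have h2 := congrArg (· % D) h
  simp only [mul_comm _ D, Nat.mul_add_div hD, Nat.mul_add_mod, Nat.div_eq_of_lt hb,
    Nat.div_eq_of_lt hb', Nat.mod_eq_of_lt hb, Nat.mod_eq_of_lt hb', add_zero] at h1 h2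
  exact ⟨h1, h2⟩

theorem State.entry_congr {s' : State} (h2 : s'.ivar 2 = s.ivar 2) (h4 : s'.rarr 4 = s.rarr 4)
    (j r c : ℕ) : s'.entry j r c = s.entry j r c := by
  rw [State.entry, State.entry, h2, h4]

theorem State.entry_setRArr {a j r c j' r' c' : ℕ} {v : ℝ}
    (ha : a = (j * s.ivar 2 + r) * s.ivar 2 + c)
    (hr : r < s.ivar 2) (hc : c < s.ivar 2) (hr' : r' < s.ivar 2) (hc' : c' < s.ivar 2) :
    (s.setRArr 4 a v).entry j' r' c' =
      if j' = j ∧ r' = r ∧ c' = c then v else s.entry j' r' c' := by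
  simp only [State.entry, State.setRArr, Function.update_self, Function.update_apply, ha,
    mul_add_inj hc' hc, mul_add_inj hr' hr, and_assoc]

theorem runs_entryAddr {y : ℕ} (hN : s.ivar 2 ≤ N) (hy : y ≠ 9 ∧ y ≠ 12 ∧ y ≠ 16) :
    Runs N (entryAddr y) s fun s' =>
      s'.ivar 10 = (s.ivar y * s.ivar 2 + s.ivar 6) * s.ivar 2 + s.ivar 7 := by
  refine runs_seq ((runs_mulAdd hN (by decide) hy (by decide)).imp fun s₁ hF h9 => ?_)
  have h2 : s₁.ivar 2 = s.ivar 2 := hF.ivar 2 rfl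
  refine (runs_mulAdd (h2.trans_le hN) (by decide) (by decide) (by decide)).imp fun s' _ h => ?_
  rw [h, h9, h2, hF.ivar 7 rfl]

theorem runs_loadPoint (hN : s.ivar 0 ≤ N) :
    Runs N loadPoint s fun s' =>
      (∀ c < s.ivar 0, s'.rarr 2 c = s.rarr 0 (s.ivar 4 * s.ivar 0 + c)) ∧
        s'.rarr 2 (s.ivar 0) = -1 := by
  refine runs_seq ((runs_forTo (fun m s' => ∀ c < m, s'.rarr 2 c =
    s.rarr 0 (s.ivar 4 * s.ivar 0 + c)) hN (by decide) rfl rfl (fun _ _ _ _ h => h)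
    (fun c hc => absurd hc (by omega)) fun m s₁ hm hF hi hj => ?_).imp fun s₁ hF h => ?_)
  · have h0 : s₁.ivar 0 = s.ivar 0 := hF.ivar 0 rfl
    refine runs_seq ((runs_mulAdd (h0.trans_le hN) (by decide) (by decide) (by decide)).imp
      fun s₂ hF₂ h9 => ?_)
    refine runs_instr_seq rfl (runs_instr rfl fun c hc => ?_)
    have h7 : s₂.ivar 7 = m := (hF₂.ivar 7 rfl).trans hi
    have h2 : s₂.rarr 2 = s₁.rarr 2 := hF₂.rarr 2 rfl
    have hr : s₂.rarr 0 = s.rarr 0 := (hF₂.rarr 0 rfl).trans (hF.rarr 0 rfl)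
    have h4 : s₁.ivar 4 = s.ivar 4 := hF.ivar 4 rfl
    rw [h0, hi, h4] at h9
    simp only [State.setRArr, State.setR, Function.update_self, Function.update_apply, h7, h2, h9,
      hr]
    split_ifs with hcm
    · rw [hcm]
    · exact hj c (by omega)
  · refine runs_instr_seq rfl (runs_instr rfl ⟨fun c hc => ?_, ?_⟩)
    · have h0 : s₁.ivar 0 = s.ivar 0 := hF.ivar 0 rfl
      simp [State.setRArr, State.setR, h0, hc.ne, h c hc]
    · have h0 : s₁.ivar 0 = s.ivar 0 := hF.ivar 0 rfl
      simp [State.setRArr, State.setR, h0]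

theorem runs_rowDot (hN : s.ivar 2 ≤ N) :
    Runs N rowDot s fun s' => s'.rvar 4 =
      ∑ c ∈ Finset.range (s.ivar 2), s.entry (s.ivar 5) (s.ivar 6) c * s.rarr 2 c := by
  refine runs_instr_seq rfl (runs_forTo (fun m s' => s'.rvar 4 =
      ∑ c ∈ Finset.range m, s.entry (s.ivar 5) (s.ivar 6) c * s.rarr 2 c) hN (by decide) rfl rfl
    (fun _ _ _ _ h => h) (by simp [State.setR, State.setI]) fun m s₁ hm hF hi hj => ?_)
  have h2 : s₁.ivar 2 = s.ivar 2 := hF.ivar 2 rfl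
  refine runs_seq ((runs_entryAddr (h2.trans_le hN) (by decide)).imp fun s₂ hF₂ h10 => ?_)
  refine runs_instr_seq rfl (runs_instr_seq rfl (runs_instr_seq rfl (runs_instr rfl ?_)))
  have h5 : s₁.ivar 5 = s.ivar 5 := hF.ivar 5 rfl
  have h6 : s₁.ivar 6 = s.ivar 6 := hF.ivar 6 rfl
  have h7 : s₂.ivar 7 = m := (hF₂.ivar 7 rfl).trans hi
  have hr2 : s₂.rarr 2 = s.rarr 2 := (hF₂.rarr 2 rfl).trans (hF.rarr 2 rfl)
  have hr4 : s₂.rarr 4 = s.rarr 4 := (hF₂.rarr 4 rfl).trans (hF.rarr 4 rfl)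
  have hv4 : s₂.rvar 4 = s₁.rvar 4 := hF₂.rvar 4 rfl
  rw [h2, h5, h6, hi] at h10
  simp [State.setR, h10, h7, hr2, hr4, hv4, hj, Finset.sum_range_succ, State.entry]

theorem runs_projectPoint (hN : s.ivar 2 ≤ N) :
    Runs N projectPoint s fun s' =>
      (∀ r < s.ivar 2, s'.rarr 3 r =
        ∑ c ∈ Finset.range (s.ivar 2), s.entry (s.ivar 5) r c * s.rarr 2 c) ∧
      s'.rvar 3 = ∑ r ∈ Finset.range (s.ivar 2), s'.rarr 3 r * s'.rarr 3 r := by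
  refine runs_instr_seq rfl (runs_forTo (fun m s' => (∀ r < m, s'.rarr 3 r =
        ∑ c ∈ Finset.range (s.ivar 2), s.entry (s.ivar 5) r c * s.rarr 2 c) ∧
      s'.rvar 3 = ∑ r ∈ Finset.range m, s'.rarr 3 r * s'.rarr 3 r) hN (by decide) rfl rfl
    (fun _ _ _ _ h => h) (by simp [State.setR, State.setI]) fun m s₁ hm hF hi hj => ?_)
  have h2 : s₁.ivar 2 = s.ivar 2 := hF.ivar 2 rfl
  refine runs_seq ((runs_rowDot (h2.trans_le hN)).imp fun s₂ hF₂ h4 => ?_)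
  refine runs_instr_seq rfl (runs_instr_seq rfl (runs_instr rfl ?_))
  have h5 : s₁.ivar 5 = s.ivar 5 := hF.ivar 5 rfl
  have h6 : s₂.ivar 6 = m := (hF₂.ivar 6 rfl).trans hi
  have hr2 : s₁.rarr 2 = s.rarr 2 := hF.rarr 2 rfl
  have hr3 : s₂.rarr 3 = s₁.rarr 3 := hF₂.rarr 3 rfl
  have hr4 : s₁.rarr 4 = s.rarr 4 := hF.rarr 4 rfl
  have hv3 : s₂.rvar 3 = s₁.rvar 3 := hF₂.rvar 3 rfl
  simp only [State.entry_congr h2 hr4, h2, h5, hi, hr2] at h4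
  refine ⟨fun r hr => ?_, ?_⟩
  · simp only [State.setRArr, State.setR, h6, hr3, Function.update_self, Function.update_apply]
    split_ifs with hrm
    · rw [h4, hrm]
    · exact hj.1 r (by omega)
  · simp only [State.setRArr, State.setR, h6, hr3, Finset.sum_range_succ, Function.update_self]
    rw [Function.update_of_ne (by decide), hv3, hj.2]
    congr 1
    refine Finset.sum_congr rfl fun r hr => ?_
    rw [Function.update_of_ne (Finset.mem_range.1 hr).ne]

/-- The value that `writeEntry` computes. -/
noncomputable def State.newEntry (s : State) (r c : ℕ) : ℝ :=
  s.entry (s.ivar 5) r c - s.rarr 3 r * s.rarr 3 c / s.rvar 3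

theorem runs_writeEntry (hN : s.ivar 2 ≤ N) (hq : s.rvar 3 ≠ 0) (hr : s.ivar 6 < s.ivar 2)
    (hc : s.ivar 7 < s.ivar 2) :
    Runs N writeEntry s fun s' => ∀ j' r' c', r' < s.ivar 2 → c' < s.ivar 2 →
      s'.entry j' r' c' = if j' = s.ivar 13 ∧ r' = s.ivar 6 ∧ c' = s.ivar 7 then
        s.newEntry (s.ivar 6) (s.ivar 7) else s.entry j' r' c' := by
  refine runs_seq ((runs_entryAddr hN (by decide)).imp fun s₁ hF h10 => ?_)
  refine runs_instr_seq rfl (runs_instr_seq rfl (runs_instr_seq rfl (runs_instr_seq rfl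
    (runs_instr_seq (if_neg ?_) (runs_instr_seq rfl ?_)))))
  · simpa [State.setR, hF.rvar 3 rfl] using hq
  set s₂ := State.setR _ 1 _ with hs₂
  have hv1 : s₂.rvar 1 = s.newEntry (s.ivar 6) (s.ivar 7) := by
    simp [hs₂, State.setR, hF.rvar 3 rfl, hF.rarr 3 rfl, hF.rarr 4 rfl, h10, hF.ivar 6 rfl,
      hF.ivar 7 rfl, State.newEntry, State.entry]
  have hi : s₂.ivar = s₁.ivar := rfl
  have hr4 : s₂.rarr 4 = s.rarr 4 := hF.rarr 4 rfl
  have hI : ∀ x, (entryAddr 5).anyInstr (·.writesI x) = false →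
      s₂.ivar x = s.ivar x := fun x hx => by
    rw [hi, hF.ivar x hx]
  clear_value s₂
  refine runs_seq ((runs_entryAddr ((hI 2 rfl).trans_le hN) (by decide)).imp fun s₃ hF₃ h10' => ?_)
  refine runs_instr rfl fun j' r' c' hr' hc' => ?_
  have h2 : s₃.ivar 2 = s.ivar 2 := (hF₃.ivar 2 rfl).trans (hI 2 rfl)
  rw [hI 13 rfl, hI 2 rfl, hI 6 rfl, hI 7 rfl] at h10'
  rw [State.entry_setRArr (j := s.ivar 13) (r := s.ivar 6) (c := s.ivar 7) (by rw [h10', h2])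
    (by omega) (by omega) (by omega) (by omega), hF₃.rvar 1 rfl, hv1,
    State.entry_congr h2 ((hF₃.rarr 4 rfl).trans hr4)]

theorem runs_writeMatrix (hN : s.ivar 2 ≤ N) (hq : s.rvar 3 ≠ 0) (hj : s.ivar 13 ≠ s.ivar 5) :
    Runs N writeMatrix s fun s' => ∀ r c, r < s.ivar 2 → c < s.ivar 2 →
      s'.entry (s.ivar 13) r c = s.newEntry r c ∧
      ∀ j' ≠ s.ivar 13, s'.entry j' r c = s.entry j' r c := by
  -- the state of the matrices when the entries before `(r₀, c₀)` have been written
  let J : ℕ → ℕ → State → Prop := fun r₀ c₀ s' => s'.ivar 2 = s.ivar 2 ∧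
    ∀ r c, r < s.ivar 2 → c < s.ivar 2 →
      (r < r₀ ∨ r = r₀ ∧ c < c₀ → s'.entry (s.ivar 13) r c = s.newEntry r c) ∧
      ∀ j' ≠ s.ivar 13, s'.entry j' r c = s.entry j' r c
  have hset : ∀ {r₀ c₀ : ℕ} {s₁ : State} {x y z : ℕ}, z ≠ 2 → J r₀ c₀ s₁ →
      J r₀ c₀ ((s₁.setI 16 x).setI z y) := by
    intro r₀ c₀ s₁ x y z hz h
    have : ((s₁.setI 16 x).setI z y).ivar 2 = s₁.ivar 2 := by simp [State.setI, hz.symm]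
    refine ⟨this.trans h.1, fun r c hr hc => ?_⟩
    simp only [State.entry_congr (s' := (s₁.setI 16 x).setI z y) this rfl]
    exact h.2 r c hr hc
  refine (runs_forTo (fun m => J m 0) hN (by decide) rfl rfl (fun _ _ _ _ => hset (by decide))
    ⟨rfl, fun r c hr hc => ⟨fun h => absurd h (by omega), fun _ _ => rfl⟩⟩
    fun r₀ s₁ hr₀ hF hi hj₁ => ?_).imp
      fun s' _ h r c hr hc => ⟨(h.2 r c hr hc).1 (.inl hr), (h.2 r c hr hc).2⟩
  have h2 : s₁.ivar 2 = s.ivar 2 := hj₁.1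
  refine (runs_forTo (J r₀) (h2.trans_le hN) (by decide) rfl rfl
    (fun _ _ _ _ => hset (by decide)) ?_ fun c₀ s₂ hc₀ hF₂ hi₂ hj₂ => ?_).imp fun s' _ h => ?_
  · exact hj₁
  · have hF' : Frame writeMatrix s s₂ := hF.trans (hF₂.mono fun f hf => by
      simp_all [Prog.forTo, Prog.anyInstr])
    have h22 := hj₂.1
    have h6 : s₂.ivar 6 = r₀ := (hF₂.ivar 6 rfl).trans hi
    have h13 : s₂.ivar 13 = s.ivar 13 := hF'.ivar 13 rfl
    have h5 : s₂.ivar 5 = s.ivar 5 := hF'.ivar 5 rfl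
    refine (runs_writeEntry (h22.trans_le hN) (by rwa [hF'.rvar 3 rfl]) (by omega)
      (by omega)).imp fun s' hF₃ h => ⟨(hF₃.ivar 2 rfl).trans h22, fun r c hr hc => ?_⟩
    have hold := hj₂.2 r c hr hc
    rw [h22, h6, h13, hi₂] at h
    refine ⟨fun hrc => ?_, fun j' hj' => ?_⟩
    · rw [h _ r c hr hc]
      split_ifs with heq
      · obtain ⟨-, rfl, rfl⟩ := heq
        simp only [State.newEntry, h5, hF'.rarr 3 rfl, hF'.rvar 3 rfl, hold.2 _ hj.symm]
      · exact hold.1 (by omega)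
    · rw [h _ r c hr hc, if_neg fun h => hj' h.1, hold.2 j' hj']
  · rw [h2] at h
    refine ⟨h.1, fun r c hr hc => ⟨fun hrc => (h.2 r c hr hc).1 (by omega), (h.2 r c hr hc).2⟩⟩

theorem runs_outputRow (hN : s.ivar 2 ≤ N) :
    Runs N outputRow s fun s' => ∀ c < s.ivar 2,
      s'.rarr 1 c = s.entry (s.ivar 13) (s.ivar 6) c := by
  refine runs_forTo (fun m s' => ∀ c < m, s'.rarr 1 c = s.entry (s.ivar 13) (s.ivar 6) c)
    hN (by decide) rfl rfl (fun _ _ _ _ h => h) (fun c hc => absurd hc (by omega))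
    fun m s₁ hm hF hi hj => ?_
  have h2 : s₁.ivar 2 = s.ivar 2 := hF.ivar 2 rfl
  refine runs_seq ((runs_entryAddr (h2.trans_le hN) (by decide)).imp fun s₂ hF₂ h10 => ?_)
  refine runs_instr_seq rfl (runs_instr rfl fun c hc => ?_)
  have h13 : s₁.ivar 13 = s.ivar 13 := hF.ivar 13 rfl
  have h6 : s₁.ivar 6 = s.ivar 6 := hF.ivar 6 rfl
  have h7 : s₂.ivar 7 = m := (hF₂.ivar 7 rfl).trans hi
  have hr1 : s₂.rarr 1 = s₁.rarr 1 := hF₂.rarr 1 rfl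
  have hr4 : s₂.rarr 4 = s.rarr 4 := (hF₂.rarr 4 rfl).trans (hF.rarr 4 rfl)
  rw [h2, h13, h6, hi] at h10
  simp only [State.setRArr, State.setR, h7, hr1, hr4, h10, Function.update_self,
    Function.update_apply]
  split_ifs with hcm
  · rw [hcm, State.entry]
  · exact hj c (by omega)

theorem runs_updateBest (hN : s.ivar 2 ≤ N) :
    Runs N updateBest s fun s' =>
      (s'.ivar 8 = s.ivar 8 ∧ s'.rarr 1 = s.rarr 1 ∧
        (s.ivar 8 < s.ivar 11 → ∀ r < s.ivar 2, s.entry (s.ivar 13) r r = 0)) ∨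
      (s.ivar 8 < s.ivar 11 ∧ s'.ivar 8 = s.ivar 11 ∧
        ∃ r < s.ivar 2, s.entry (s.ivar 13) r r ≠ 0 ∧
          ∀ c < s.ivar 2, s'.rarr 1 c = s.entry (s.ivar 13) r c) := by
  refine runs_forTo (fun m s' => (s'.ivar 8 = s.ivar 8 ∧ s'.rarr 1 = s.rarr 1 ∧
        (s.ivar 8 < s.ivar 11 → ∀ r < m, s.entry (s.ivar 13) r r = 0)) ∨
      (s.ivar 8 < s.ivar 11 ∧ s'.ivar 8 = s.ivar 11 ∧
        ∃ r < s.ivar 2, s.entry (s.ivar 13) r r ≠ 0 ∧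
          ∀ c < s.ivar 2, s'.rarr 1 c = s.entry (s.ivar 13) r c))
    hN (by decide) rfl rfl (fun _ _ _ _ h => h)
    (.inl ⟨rfl, rfl, fun _ r hr => absurd hr (by omega)⟩) fun m s₁ hm hF hi hj => ?_
  have h2 : s₁.ivar 2 = s.ivar 2 := hF.ivar 2 rfl
  refine runs_instr_seq rfl (runs_seq ((runs_entryAddr (s := s₁.setI 7 (s₁.ivar 6))
    (h2.trans_le hN) (by decide)).imp fun s₂ hF₂ h10 => ?_))
  have h13 : s₁.ivar 13 = s.ivar 13 := hF.ivar 13 rfl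
  have h62 : s₂.ivar 6 = m := (hF₂.ivar 6 rfl).trans hi
  have h132 : s₂.ivar 13 = s.ivar 13 := (hF₂.ivar 13 rfl).trans h13
  have h82 : s₂.ivar 8 = s₁.ivar 8 := hF₂.ivar 8 rfl
  have h112 : s₂.ivar 11 = s.ivar 11 := (hF₂.ivar 11 rfl).trans (hF.ivar 11 rfl)
  have h22 : s₂.ivar 2 = s.ivar 2 := (hF₂.ivar 2 rfl).trans h2
  have hr4 : s₂.rarr 4 = s.rarr 4 := (hF₂.rarr 4 rfl).trans (hF.rarr 4 rfl)
  have hr1 : s₂.rarr 1 = s₁.rarr 1 := hF₂.rarr 1 rfl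
  have haddr : s₂.ivar 10 = (s.ivar 13 * s.ivar 2 + m) * s.ivar 2 + m := by
    rw [h10]; simp [State.setI, hi, h13, h2]
  refine runs_instr_seq rfl (runs_instr_seq rfl ?_)
  set s₃ := State.setR _ 5 _ with hs₃
  have hzero : Test.Holds (.req 1 5) s₃ ↔ s.entry (s.ivar 13) m m = 0 := by
    simp [Test.Holds, hs₃, State.setR, haddr, hr4, State.entry]
  have hlt : Test.Holds (.ilt 8 11) s₃ ↔ s₁.ivar 8 < s.ivar 11 := by
    rw [← h82, ← h112]; rfl
  have e8 : s₃.ivar 8 = s₁.ivar 8 := h82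
  have e1 : s₃.rarr 1 = s₁.rarr 1 := hr1
  refine runs_ifElse (fun hb => runs_skip ?_) fun hb =>
    runs_ifElse (fun hb' => ?_) fun hb' => runs_skip ?_
  · rw [hzero] at hb
    rw [e8, e1]
    refine hj.imp_left fun h => ⟨h.1, h.2.1, fun hlt r hr => ?_⟩
    rcases Nat.lt_succ_iff_lt_or_eq.1 hr with hr | rfl
    · exact h.2.2 hlt r hr
    · exact hb
  · rw [hzero] at hb
    rw [hlt] at hb'
    refine runs_instr_seq rfl ((runs_outputRow
      (s := s₃.setI 8 (s₃.ivar 11)) (h22.trans_le hN)).imp fun s' hF' h => .inr ?_)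
    have hlt' : s.ivar 8 < s.ivar 11 := by
      rcases hj with h | h
      · omega
      · exact h.1
    refine ⟨hlt', (hF'.ivar 8 rfl).trans h112, m, hm, hb, fun c hc => ?_⟩
    rw [h c (by rw [← h22] at hc; exact hc)]
    simp [State.entry, State.setI, hs₃, State.setR, h132, h22, h62, hr4]
  · rw [hlt] at hb'
    rw [e8, e1]
    refine hj.imp_left fun h => ⟨h.1, h.2.1, fun hlt => absurd hlt (by omega)⟩

theorem runs_setup (hN : s.ivar 0 + 1 ≤ N) (h9 : s.ivar 9 = 0) (h4 : s.rarr 4 = 0) :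
    Runs N setup s fun s' => s'.ivar 2 = s.ivar 0 + 1 ∧ s'.ivar 3 = 1 ∧ s'.ivar 14 = 1 ∧
      s'.rarr 1 = Function.update (s.rarr 1) 0 1 ∧
      ∀ r c, r < s.ivar 0 + 1 → c < s.ivar 0 + 1 → s'.entry 0 r c = if r = c then 1 else 0 := by
  refine runs_instr_seq rfl (runs_instr_seq rfl (runs_instr_seq rfl (runs_instr_seq rfl ?_)))
  set s₁ := State.setRArr _ 1 _ _ with hs₁
  have h2 : s₁.ivar 2 = s.ivar 0 + 1 := by simp [hs₁, State.setRArr, State.setR, State.setI]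
  have h14 : s₁.ivar 14 = 1 := by simp [hs₁, State.setRArr, State.setR, State.setI]
  have hr1 : s₁.rarr 1 = Function.update (s.rarr 1) 0 1 := by
    simp [hs₁, State.setRArr, State.setR, State.setI, h9]
  have hr4 : s₁.rarr 4 = 0 := by simp [hs₁, State.setRArr, State.setR, State.setI, h4]
  have hv1 : s₁.rvar 1 = 1 := by simp [hs₁, State.setRArr, State.setR]
  clear_value s₁
  refine runs_seq ((runs_forTo (fun m s' => s'.ivar 2 = s.ivar 0 + 1 ∧
    ∀ r c, r < s.ivar 0 + 1 → c < s.ivar 0 + 1 → s'.entry 0 r c =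
      if r = c ∧ r < m then 1 else 0) (h2.trans_le hN) (by decide) rfl rfl ?_ ?_
      fun m s₂ hm hF hi hj => ?_).imp fun s₂ hF h => ?_)
  · intro m s₂ x y h
    refine ⟨by simpa [State.setI] using h.1, fun r c hr hc => ?_⟩
    rw [State.entry_congr (s' := (s₂.setI 16 x).setI 6 y) (s := s₂) (by simp [State.setI]) rfl,
      h.2 r c hr hc]
  · exact ⟨h2, fun r c _ _ => by simp [State.entry, State.setI, hr4]⟩
  · refine runs_seq ((runs_mulAdd (by omega) (by decide) (by decide) (by decide)).imp
      fun s₃ hF₃ ha => ?_)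
    have h22 : s₃.ivar 2 = s.ivar 0 + 1 := (hF₃.ivar 2 rfl).trans hj.1
    refine runs_instr rfl ⟨h22, fun r c hr hc => ?_⟩
    have hm' : m < s₃.ivar 2 := by omega
    rw [State.entry_setRArr (j := 0) (r := m) (c := m) (by rw [ha, hi, hj.1, h22]; ring) hm' hm'
      (by omega) (by omega), State.entry_congr (hF₃.ivar 2 rfl) (hF₃.rarr 4 rfl), hj.2 r c hr hc,
      hF₃.rvar 1 rfl, hF.rvar 1 rfl, hv1]
    by_cases hrc : r = c
    · subst hrc
      simp only [true_and, and_self]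
      split_ifs <;> first | rfl | omega
    · rw [if_neg (by omega), if_neg (by tauto), if_neg (by tauto)]
  · refine runs_instr rfl ⟨h.1, rfl, (hF.ivar 14 rfl).trans h14, (hF.rarr 1 rfl).trans hr1,
      fun r c hr hc => ?_⟩
    rw [State.entry_congr (s' := s₂.setI 3 1) (s := s₂) (by simp [State.setI]) rfl, h.2 r c hr hc]
    simp [h2, hr]

end RealRAM

namespace RealRAM
open Matrix
variable {N : ℕ} {s : State}

/-! ### Correctness of the program -/

/-- The square matrices of side length `d + 1` stored one after the other in an array. -/
def toMatrix (d : ℕ) (A : ℕ → ℝ) (j : ℕ) : Matrix (Fin (d + 1)) (Fin (d + 1)) ℝ :=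
  .of fun r c => A ((j * (d + 1) + r) * (d + 1) + c)

/-- The first `d + 1` cells of an array. -/
def toVec (d : ℕ) (a : ℕ → ℝ) (c : Fin (d + 1)) : ℝ := a c

theorem toMatrix_apply {d : ℕ} (hD : s.ivar 2 = d + 1) (j : ℕ) (r c : Fin (d + 1)) :
    toMatrix d (s.rarr 4) j r c = s.entry j r c := by
  rw [State.entry, hD, toMatrix, of_apply]

theorem runs_extendSubset {d : ℕ} (hN : s.ivar 2 ≤ N) (hD : s.ivar 2 = d + 1)
    (hone : s.ivar 14 = 1) (hL : 0 < s.ivar 3) :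
    Runs N extendSubset s fun s' =>
      toMatrix d (s'.rarr 4) (s.ivar 3 + s.ivar 5) =
        projStep (toMatrix d (s.rarr 4) (s.ivar 5)) (toVec d (s.rarr 2)) ∧
      (∀ j ≠ s.ivar 3 + s.ivar 5, toMatrix d (s'.rarr 4) j = toMatrix d (s.rarr 4) j) ∧
      s'.iarr 0 = Function.update (s.iarr 0) (s.ivar 3 + s.ivar 5) (s.iarr 0 (s.ivar 5) + 1) ∧
      ((s'.ivar 8 = s.ivar 8 ∧ s'.rarr 1 = s.rarr 1 ∧ (s.ivar 8 < s.iarr 0 (s.ivar 5) + 1 →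
          ∀ r, toMatrix d (s'.rarr 4) (s.ivar 3 + s.ivar 5) r r = 0)) ∨
        (s.ivar 8 < s.iarr 0 (s.ivar 5) + 1 ∧ s'.ivar 8 = s.iarr 0 (s.ivar 5) + 1 ∧
          ∃ r, toMatrix d (s'.rarr 4) (s.ivar 3 + s.ivar 5) r r ≠ 0 ∧
            toVec d (s'.rarr 1) = toMatrix d (s'.rarr 4) (s.ivar 3 + s.ivar 5) r)) := by
  refine runs_instr_seq rfl ?_
  set s₁ := State.setI _ 13 _ with hs₁
  have h13 : s₁.ivar 13 = s.ivar 3 + s.ivar 5 := by simp [hs₁, State.setI]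
  have hF₁ : Frame (.instr (.iadd 13 3 5)) s s₁ := Instr.frame rfl
  clear_value s₁
  have h21 : s₁.ivar 2 = d + 1 := (hF₁.ivar 2 rfl).trans hD
  rw [hD] at hN
  refine runs_seq ((runs_projectPoint (h21.trans_le hN)).imp fun s₂ hF₂ h₂ => ?_)
  have h22 : s₂.ivar 2 = d + 1 := (hF₂.ivar 2 rfl).trans h21
  -- the vector `M v` and its squared length
  set M := toMatrix d (s.rarr 4) (s.ivar 5) with hM
  set v := toVec d (s.rarr 2) with hv
  set w := M *ᵥ v with hw
  have hw3 : ∀ r : Fin (d + 1), s₂.rarr 3 r = w r := fun r => by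
    rw [h₂.1 r (by rw [h21]; exact r.2), h21, Finset.sum_range, hw, mulVec, dotProduct]
    refine Finset.sum_congr rfl fun c _ => ?_
    rw [hM, toMatrix_apply hD, State.entry_congr (hF₁.ivar 2 rfl) (hF₁.rarr 4 rfl),
      hF₁.ivar 5 rfl, hF₁.rarr 2 rfl, hv, toVec]
  have hq : s₂.rvar 3 = w ⬝ᵥ w := by
    rw [h₂.2, h21, Finset.sum_range, dotProduct]
    exact Finset.sum_congr rfl fun c _ => by rw [hw3]
  -- after the test the divisor is nonzero, and the quotients are as if it had not been changed
  have hguard : Runs N (.seq (.instr (.rconst 5 0))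
      (.ifElse (.req 3 5) (.instr (.rconst 3 1)) .skip)) s₂
      fun s' => s'.rvar 3 ≠ 0 ∧ ∀ r c, w r * w c / s'.rvar 3 = w r * w c / (w ⬝ᵥ w) := by
    refine runs_instr_seq rfl (runs_ifElse (fun hb => runs_instr rfl ?_) fun hb => runs_skip ?_)
    · have h0 : w ⬝ᵥ w = 0 := by simpa [Test.Holds, State.setR, hq] using hb
      rw [dotProduct_self_eq_zero] at h0
      simp [State.setR, h0]
    · have h0 : w ⬝ᵥ w ≠ 0 := by simpa [Test.Holds, State.setR, hq] using hb
      simp [State.setR, hq, h0]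
  refine runs_seq (hguard.imp fun s₃ hF₃ h₃ => ?_)
  have h23 : s₃.ivar 2 = d + 1 := (hF₃.ivar 2 rfl).trans h22
  have h133 : s₃.ivar 13 = s.ivar 3 + s.ivar 5 :=
    (hF₃.ivar 13 rfl).trans ((hF₂.ivar 13 rfl).trans h13)
  have h53 : s₃.ivar 5 = s.ivar 5 :=
    (hF₃.ivar 5 rfl).trans ((hF₂.ivar 5 rfl).trans (hF₁.ivar 5 rfl))
  have h43 : s₃.rarr 4 = s.rarr 4 :=
    (hF₃.rarr 4 rfl).trans ((hF₂.rarr 4 rfl).trans (hF₁.rarr 4 rfl))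
  refine runs_seq ((runs_writeMatrix (h23.trans_le hN) h₃.1 (by omega)).imp fun s₄ hF₄ h₄ => ?_)
  have h24 : s₄.ivar 2 = d + 1 := (hF₄.ivar 2 rfl).trans h23
  rw [h23, h133] at h₄
  have hnew : toMatrix d (s₄.rarr 4) (s.ivar 3 + s.ivar 5) = projStep M v := by
    ext r c
    rw [toMatrix_apply h24, (h₄ r c r.2 c.2).1, State.newEntry, hF₃.rarr 3 rfl, hw3, hw3, h₃.2,
      ← toMatrix_apply h23, h43, h53]
    rfl
  have hold : ∀ j ≠ s.ivar 3 + s.ivar 5,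
      toMatrix d (s₄.rarr 4) j = toMatrix d (s.rarr 4) j := fun j hj => by
    ext r c
    rw [toMatrix_apply h24, (h₄ r c r.2 c.2).2 j hj, ← toMatrix_apply h23, h43]
  have hI : ∀ x, writeMatrix.anyInstr (·.writesI x) = false →
      projectPoint.anyInstr (·.writesI x) = false → (13 == x) = false →
      s₄.ivar x = s.ivar x := fun x hx hx' hx'' => by
    rw [hF₄.ivar x hx, hF₃.ivar x rfl, hF₂.ivar x hx', hF₁.ivar x hx'']
  have hcnt : s₄.iarr 0 = s.iarr 0 := by
    rw [hF₄.iarr 0 rfl, hF₃.iarr 0 rfl, hF₂.iarr 0 rfl, hF₁.iarr 0 rfl]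
  have hr1 : s₄.rarr 1 = s.rarr 1 := by
    rw [hF₄.rarr 1 rfl, hF₃.rarr 1 rfl, hF₂.rarr 1 rfl, hF₁.rarr 1 rfl]
  have h134 : s₄.ivar 13 = s.ivar 3 + s.ivar 5 := (hF₄.ivar 13 rfl).trans h133
  have h54 := hI 5 rfl rfl rfl
  have h84 := hI 8 rfl rfl rfl
  have h144 := hI 14 rfl rfl rfl
  refine runs_seq (runs_instr_seq rfl (runs_instr_seq rfl (runs_instr rfl ?_)))
  set s₅ := State.setIArr _ 0 _ _ with hs₅
  have h25 : s₅.ivar 2 = d + 1 := h24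
  have h85 : s₅.ivar 8 = s.ivar 8 := h84
  have h115 : s₅.ivar 11 = s.iarr 0 (s.ivar 5) + 1 := by
    simp [hs₅, State.setIArr, State.setI, h144, h54, hcnt, hone]
  have h135 : s₅.ivar 13 = s.ivar 3 + s.ivar 5 := h134
  have hcnt5 : s₅.iarr 0 =
      Function.update (s.iarr 0) (s.ivar 3 + s.ivar 5) (s.iarr 0 (s.ivar 5) + 1) := by
    simp [hs₅, State.setIArr, State.setI, h144, h54, hcnt, hone, h134]
  have hr45 : s₅.rarr 4 = s₄.rarr 4 := rfl
  have hr15 : s₅.rarr 1 = s.rarr 1 := hr1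
  clear_value s₅
  refine (runs_updateBest (h25.trans_le hN)).imp fun s' hF' h => ?_
  have hr4' : s'.rarr 4 = s₄.rarr 4 := (hF'.rarr 4 rfl).trans hr45
  rw [hr4', hnew]
  refine ⟨rfl, hold, (hF'.iarr 0 rfl).trans hcnt5, ?_⟩
  rw [← hnew, ← hr45]
  rw [h85, h115, h135, hr15, h25] at h
  simp only [toMatrix_apply h25]
  refine h.imp (fun h => ⟨h.1, h.2.1, fun hlt r => h.2.2 hlt r r.2⟩) ?_
  rintro ⟨hlt, h8, r, hr, hne, hrow⟩
  refine ⟨hlt, h8, ⟨r, hr⟩, hne, ?_⟩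
  ext c
  rw [toMatrix_apply h25]
  exact hrow c c.2

/-- The vector `(x, -1)` for point number `t` of an input array. -/
def homVec (d : ℕ) (X : ℕ → ℝ) (t : ℕ) : Fin (d + 1) → ℝ :=
  Fin.snoc (fun c : Fin d => X (t * d + c)) (-1)

/-- The invariant of the main loop. -/
def MainInv (d k : ℕ) (X : ℕ → ℝ) (m : ℕ) (s : State) : Prop :=
  ∃ start nb sub, BlockInv (homVec d X) k m start nb sub (s.ivar 3) (s.ivar 8) (s.iarr 0)
    (toMatrix d (s.rarr 4)) (toVec d (s.rarr 1))

theorem runs_extendLoop {d k m start nb L : ℕ} {sub : ℕ → Finset ℕ} {v : ℕ → Fin (d + 1) → ℝ}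
    (hlast : ∀ t, v t (Fin.last d) = -1) (hN : s.ivar 2 ≤ N) (hD : s.ivar 2 = d + 1)
    (hone : s.ivar 14 = 1) (hL : s.ivar 3 = L) (hLN : L ≤ N) (hv : toVec d (s.rarr 2) = v m)
    (h : BlockInv v k m start nb sub L (s.ivar 8) (s.iarr 0)
      (toMatrix d (s.rarr 4)) (toVec d (s.rarr 1))) :
    Runs N (.forTo 5 3 extendSubset) s fun s' =>
      BlockInv v k (m + 1) start nb (fun j => if j < L then sub j else insert m (sub (j - L)))
      (L + L) (s'.ivar 8) (s'.iarr 0)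
      (toMatrix d (s'.rarr 4)) (toVec d (s'.rarr 1)) := by
  have hL0 : 0 < L := h.length ▸ Nat.two_pow_pos _
  have hm : ∀ j < L, m ∉ sub j := fun j hj hmem => by simpa using h.sub_subset j hj hmem
  refine (runs_forTo (i := 5) (n := 3) (fun l s' => s.ivar 8 ≤ s'.ivar 8 ∧
      (∀ j < L, toMatrix d (s'.rarr 4) j = toMatrix d (s.rarr 4) j ∧ s'.iarr 0 j = s.iarr 0 j) ∧
      (∀ j < l, Represents v (toMatrix d (s'.rarr 4)) (s'.iarr 0) (L + j) (insert m (sub j))) ∧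
      (∀ j < l, ∀ x ≠ 0, (∀ t ∈ insert m (sub j), v t ⬝ᵥ x = 0) →
        (insert m (sub j)).card ≤ s'.ivar 8) ∧
      IsWitness v (m + 1) (s'.ivar 8) (toVec d (s'.rarr 1)))
    (hL.trans_le hLN) (by decide) rfl rfl (fun _ _ _ _ h => h)
    ⟨le_rfl, fun _ _ => ⟨rfl, rfl⟩, fun _ h => absurd h (by omega), fun _ h => absurd h (by omega),
      h.witness.mono (Nat.le_succ m)⟩ fun l s₁ hl hF hi hj => ?_).imp
    fun s' _ h' => by
      rw [hL] at h'
      exact h.step h'.1 h'.2.1 h'.2.2.1 h'.2.2.2.1 h'.2.2.2.2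
  obtain ⟨hbest, hsame, hnew, hmax, hwit⟩ := hj
  rw [hL] at hl
  have h21 : s₁.ivar 2 = d + 1 := (hF.ivar 2 rfl).trans hD
  have h31 : s₁.ivar 3 = L := (hF.ivar 3 rfl).trans hL
  have hr2 : s₁.rarr 2 = s.rarr 2 := hF.rarr 2 rfl
  have hcnt : s₁.iarr 0 l = (sub l).card := by
    rw [(hsame l hl).2, (h.represents l hl).count]
  refine (runs_extendSubset (by omega) h21 ((hF.ivar 14 rfl).trans hone) (by omega)).imp
    fun s' hF' h' => ?_
  rw [h31, hi, hr2, hv, (hsame l hl).1, hcnt] at h'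
  obtain ⟨hM, hMold, hc, hout⟩ := h'
  have hcard : (insert m (sub l)).card = (sub l).card + 1 :=
    Finset.card_insert_of_notMem (hm l hl)
  have hrep : Represents v (toMatrix d (s'.rarr 4)) (s'.iarr 0) (L + l) (insert m (sub l)) := by
    refine ⟨?_, by rw [hc, Function.update_self, hcard]⟩
    rw [hM, Finset.coe_insert, Set.image_insert_eq]
    exact (h.represents l hl).proj.insert (v m)
  have hbest' : s₁.ivar 8 ≤ s'.ivar 8 := by
    rcases hout with h | h
    · exact h.1.ge
    · omega
  refine ⟨hbest.trans hbest', fun j hj => ?_, fun j hj => ?_, fun j hj x hx hxo => ?_, ?_⟩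
  · rw [hMold j (by omega), hc, Function.update_of_ne (by omega)]
    exact hsame j hj
  · rcases Nat.lt_succ_iff_lt_or_eq.1 hj with hj | rfl
    · have := hnew j hj
      exact ⟨by rw [hMold _ (by omega)]; exact this.proj,
        by rw [hc, Function.update_of_ne (by omega)]; exact this.count⟩
    · exact hrep
  · rcases Nat.lt_succ_iff_lt_or_eq.1 hj with hj | rfl
    · exact (hmax j hj x hx hxo).trans hbest'
    · rcases hout with ⟨h8, -, h0⟩ | h
      · by_contra! hlt
        obtain ⟨r, hr⟩ := hrep.proj.exists_diag_ne_zero hx (by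
          rintro _ ⟨t, ht, rfl⟩
          exact hxo t ht)
        exact hr (h0 (by omega) r)
      · omega
  · rcases hout with ⟨h8, h1, -⟩ | ⟨-, h8, r, hr, hrow⟩
    · rw [h8, h1]
      exact hwit
    · rw [h8, hrow, ← hcard]
      refine isWitness_row hlast hrep ?_ (Finset.insert_nonempty _ _) hr
      rw [Finset.range_add_one]
      exact Finset.insert_subset_insert _ (h.sub_subset l hl)

theorem runs_processPoint {d k m : ℕ} {X : ℕ → ℝ} (hN : d + k + 1 ≤ N) (h0 : s.ivar 0 = d)
    (h1 : s.ivar 1 = k) (hD : s.ivar 2 = d + 1) (hone : s.ivar 14 = 1) (hm : s.ivar 4 = m)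
    (hX : s.rarr 0 = X) (h : MainInv d k X m s) :
    Runs N processPoint s (MainInv d k X (m + 1)) := by
  obtain ⟨start, nb, sub, h⟩ := h
  have hreset : Runs N (.ifElse (.ilt 3 1) .skip (.instr (.iconst 3 1))) s fun s' =>
      MainInv d k X m s' ∧ s'.ivar 3 ≤ N := by
    refine runs_ifElse (fun hb => runs_skip ⟨⟨start, nb, sub, h⟩, ?_⟩) fun hb =>
      runs_instr rfl ⟨⟨m, nb + 1, fun _ => ∅, h.reset ?_⟩, ?_⟩
    · simp only [Test.Holds] at hb; omega
    · simp only [Test.Holds] at hb; omega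
    · simp only [State.setI, Function.update_self]; omega
  refine runs_seq (hreset.imp fun s₁ hF₁ h₁ => ?_)
  have h01 : s₁.ivar 0 = d := (hF₁.ivar 0 rfl).trans h0
  refine runs_seq ((runs_loadPoint (by omega)).imp fun s₂ hF₂ h₂ => ?_)
  obtain ⟨⟨start, nb, sub, h⟩, hLN⟩ := h₁
  rw [h01, hF₁.ivar 4 rfl, hm, hF₁.rarr 0 rfl, hX] at h₂
  have h32 : s₂.ivar 3 = s₁.ivar 3 := hF₂.ivar 3 rfl
  have hD2 : s₂.ivar 2 = d + 1 := (hF₂.ivar 2 rfl).trans ((hF₁.ivar 2 rfl).trans hD)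
  have hv : toVec d (s₂.rarr 2) = homVec d X m := by
    ext c
    induction c using Fin.lastCases with
    | last => simpa [toVec, homVec] using h₂.2
    | cast c => simpa [toVec, homVec] using h₂.1 c c.2
  rw [← h32, ← hF₂.ivar 8 rfl, ← hF₂.iarr 0 rfl, ← hF₂.rarr 4 rfl, ← hF₂.rarr 1 rfl] at h
  refine runs_seq ((runs_extendLoop (L := s₂.ivar 3) (fun t => by simp [homVec]) (by omega) hD2
    ((hF₂.ivar 14 rfl).trans ((hF₁.ivar 14 rfl).trans hone)) rfl (by omega) hv h).imp
    fun s₃ hF₃ h₃ => ?_)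
  rw [← hF₃.ivar 3 rfl] at h₃
  exact runs_instr rfl ⟨start, nb, _, h₃⟩

theorem runs_approxHyperplane {d k : ℕ} (hd : 1 ≤ d) (P : Fin k → EuclideanSpace ℝ (Fin d))
    (hN : d + k + 1 ≤ N) :
    Runs N approxHyperplane (input P) (MainInv d k ((input P).rarr 0) k) := by
  refine runs_seq ((runs_setup (s := input P) (by simp [input]; omega) (by simp [input])
    (by ext; simp [input])).imp fun s₁ hF h => ?_)
  obtain ⟨h2, h3, h14, h1, h4⟩ := h
  have hk : s₁.ivar 1 = k := by rw [hF.ivar 1 rfl]; simp [input]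
  have h0 : s₁.ivar 0 = d := by rw [hF.ivar 0 rfl]; simp [input]
  have h8 : s₁.ivar 8 = 0 := by rw [hF.ivar 8 rfl]; simp [input]
  have hc : s₁.iarr 0 = fun _ => 0 := by rw [hF.iarr 0 rfl]; rfl
  have hd0 : (input P).ivar 0 = d := by simp [input]
  rw [hd0] at h2 h4
  have hM : toMatrix d (s₁.rarr 4) 0 = 1 := by
    ext r c
    rw [toMatrix_apply h2, h4 r c r.2 c.2, Matrix.one_apply]
    simp only [Fin.ext_iff]
  have hrep : ∀ v : ℕ → Fin (d + 1) → ℝ,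
      Represents v (toMatrix d (s₁.rarr 4)) (s₁.iarr 0) 0 ∅ := fun v =>
    ⟨by rw [hM]; simpa using IsAnnihilatorProj.one_empty, by rw [hc]; rfl⟩
  have hinit : MainInv d k ((input P).rarr 0) 0 s₁ := by
    refine ⟨0, 0, fun _ => ∅, ?_⟩
    rw [h3, h8]
    refine ⟨le_rfl, by simp, by simp, hrep _, fun j hj => ?_, by simp, fun S hS =>
      ⟨0, by simp, (by simpa using hS : S = ∅).symm⟩, by simp [orthCount], by simp [orthCount],
      ⟨⟨0, hd⟩, ?_⟩, ∅, by simp, by simp, by simp⟩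
    · obtain rfl : j = 0 := by omega
      exact hrep _
    · simp [toVec, h1]
  rw [show MainInv d k ((input P).rarr 0) k = MainInv d k ((input P).rarr 0) (s₁.ivar 1) by rw [hk]]
  refine runs_forTo (MainInv d k ((input P).rarr 0)) (by omega) (by decide) rfl rfl
    (fun _ _ _ _ h => h) hinit fun m s₂ hm hF₂ hi h => ?_
  exact runs_processPoint hN ((hF₂.ivar 0 rfl).trans h0) ((hF₂.ivar 1 rfl).trans hk)
    ((hF₂.ivar 2 rfl).trans h2) ((hF₂.ivar 14 rfl).trans h14) hi
    ((hF₂.rarr 0 rfl).trans (hF.rarr 0 rfl)) h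

end RealRAM

/-! ### The approximation ratio -/

section
open Matrix

theorem maxOnHyperplane_le {d n : ℕ} {P : Set (EuclideanSpace ℝ (Fin d))}
    (h : ∀ h, IsHyperplane h → numOn P h ≤ n) : maxOnHyperplane P ≤ n :=
  csSup_le' (by rintro _ ⟨h', hh', rfl⟩; exact h h' hh')

theorem homVec_input_dotProduct {d k : ℕ} (P : Fin k → EuclideanSpace ℝ (Fin d)) (t : Fin k)
    (x : Fin (d + 1) → ℝ) :
    RealRAM.homVec d ((RealRAM.input P).rarr 0) t ⬝ᵥ x =
      ∑ j : Fin d, x j.castSucc * P t j - x (Fin.last d) := by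
  rw [dotProduct, Fin.sum_univ_castSucc, sub_eq_add_neg]
  congr 1
  · refine Finset.sum_congr rfl fun j _ => ?_
    have hd : 0 < d := j.pos
    have h1 : ((t : ℕ) * d + j) / d = t := by
      rw [mul_comm, Nat.mul_add_div hd, Nat.div_eq_of_lt j.2, add_zero]
    rw [mul_comm]
    simp [RealRAM.homVec, RealRAM.input, h1, hd, Nat.mod_eq_of_lt j.2]
  · simp [RealRAM.homVec]

/-- A hyperplane contains at most as many points as are orthogonal, in homogeneous coordinates, to
the vector of the coefficients of its equation. -/
theorem exists_numOn_le_orthCount {d k : ℕ} (P : Fin k → EuclideanSpace ℝ (Fin d))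
    {h : AffineSubspace ℝ (EuclideanSpace ℝ (Fin d))} (hh : IsHyperplane h) :
    ∃ x ≠ 0, numOn (Set.range P) h ≤
      orthCount (RealRAM.homVec d ((RealRAM.input P).rarr 0)) (Finset.range k) x := by
  obtain ⟨a, b, ha, hab⟩ := hh.exists_equation
  refine ⟨Fin.snoc a b, fun h0 => ha ?_, ?_⟩
  · ext j
    simpa using congrFun h0 j.castSucc
  · set F := {t ∈ Finset.range k | RealRAM.homVec d ((RealRAM.input P).rarr 0) t ⬝ᵥ
      (Fin.snoc a b : Fin (d + 1) → ℝ) = 0} with hF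
    -- points with numbers in `F`; for numbers of at least `k` the value does not matter
    let p : ℕ → EuclideanSpace ℝ (Fin d) := fun t => if ht : t < k then P ⟨t, ht⟩ else 0
    have hsub : Set.range P ∩ h ⊆ p '' (F : Set ℕ) := by
      rintro _ ⟨⟨t, rfl⟩, ht⟩
      refine ⟨t, ?_, by simp [p]⟩
      rw [hF, Finset.mem_coe, Finset.mem_filter, homVec_input_dotProduct]
      refine ⟨Finset.mem_range.2 t.2, ?_⟩
      simp [hab _ ht]
    calc numOn (Set.range P) h ≤ (p '' (F : Set ℕ)).ncard :=
          Set.ncard_le_ncard hsub (F.finite_toSet.image _)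
      _ ≤ (F : Set ℕ).ncard := Set.ncard_image_le F.finite_toSet
      _ = F.card := Set.ncard_coe_finset F

theorem exists_isHyperplane_of_isWitness {d k best : ℕ} {P : Fin k → EuclideanSpace ℝ (Fin d)}
    (hP : Function.Injective P) {s : RealRAM.State}
    (hw : IsWitness (RealRAM.homVec d ((RealRAM.input P).rarr 0)) k best
      (RealRAM.toVec d (s.rarr 1))) :
    ∃ h : AffineSubspace ℝ (EuclideanSpace ℝ (Fin d)),
      RealRAM.Outputs s h ∧ IsHyperplane h ∧ best ≤ numOn (Set.range P) h := by
  obtain ⟨⟨j₀, hj₀⟩, S, hS, hcard, hdot⟩ := hw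
  obtain ⟨h, hh, hmem⟩ := exists_isHyperplane_of_equation (a := fun j : Fin d => s.rarr 1 j)
    (Function.ne_iff.2 ⟨j₀, hj₀⟩) (s.rarr 1 d)
  refine ⟨h, hmem, hh, ?_⟩
  have hlt : ∀ t : S, (t : ℕ) < k := fun t => Finset.mem_range.1 (hS t.2)
  have hinj : Function.Injective fun t : S => P ⟨t, hlt t⟩ := fun t t' htt => by
    exact Subtype.ext (Fin.ext_iff.1 (hP htt))
  have hsub : Set.range (fun t : S => P ⟨t, hlt t⟩) ⊆ Set.range P ∩ h := by
    rintro _ ⟨t, rfl⟩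
    refine ⟨⟨_, rfl⟩, (hmem _).2 ?_⟩
    have h1 := hdot t t.2
    rw [dotProduct_comm, homVec_input_dotProduct P ⟨t, hlt t⟩, sub_eq_zero] at h1
    simpa [RealRAM.toVec] using h1
  calc best = (Set.range fun t : S => P ⟨t, hlt t⟩).ncard := by
        rw [← Set.image_univ, Set.ncard_image_of_injective _ hinj, Set.ncard_univ,
          Nat.card_eq_fintype_card, Fintype.card_coe, hcard]
    _ ≤ _ := Set.ncard_le_ncard hsub ((Set.finite_range P).inter_of_left _)

end

theorem log_log_three_pos : 0 < Real.log (Real.log 3) := by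
  refine Real.log_pos ?_
  rw [Real.lt_log_iff_exp_lt (by norm_num)]
  linarith [Real.exp_one_lt_d9]

/-- The ratio follows from the count of the blocks; the factor `log log k` is bounded below by its
value at `3`. -/
theorem ratio_le {k nb best opt : ℕ} (hk : 3 ≤ k) (hnb : nb * Real.log k ≤ k)
    (hopt : opt ≤ (nb + 1) * best) :
    Real.log (Real.log 3) / 2 * (opt * Real.log k / (k * Real.log (Real.log k))) ≤ best := by
  have h3 := log_log_three_pos
  have hk3 : (3 : ℝ) ≤ k := by exact_mod_cast hk
  have hlog3 : 0 < Real.log 3 := Real.log_pos (by norm_num)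
  have hlog : Real.log 3 ≤ Real.log k := Real.log_le_log (by norm_num) hk3
  have hll : Real.log (Real.log 3) ≤ Real.log (Real.log k) := Real.log_le_log hlog3 hlog
  have hlogk : Real.log k ≤ k := (Real.log_le_sub_one_of_pos (by linarith)).trans (by linarith)
  have hb : (0 : ℝ) ≤ best := Nat.cast_nonneg _
  have hmain : (opt : ℝ) * Real.log k ≤ 2 * k * best := by
    have : (opt : ℝ) ≤ (nb + 1) * best := by exact_mod_cast hopt
    calc (opt : ℝ) * Real.log k ≤ (nb + 1) * best * Real.log k := by gcongr
      _ = (nb * Real.log k + Real.log k) * best := by ring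
      _ ≤ (k + k) * best := by gcongr
      _ = _ := by ring
  have hden : 0 < k * Real.log (Real.log k) := mul_pos (by linarith) (by linarith)
  rw [← mul_div_assoc, div_le_iff₀ hden]
  calc Real.log (Real.log 3) / 2 * (opt * Real.log k)
      ≤ Real.log (Real.log 3) / 2 * (2 * k * best) := by gcongr
    _ = best * (k * Real.log (Real.log 3)) := by ring
    _ ≤ best * (k * Real.log (Real.log k)) := by gcongr

theorem mainTheorem7 :
    ∃ (A : RealRAM.Prog) (C e : ℕ) (c : ℝ), 0 < c ∧
      ∀ (d k : ℕ), 1 ≤ d →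
        ∀ P : Fin k → EuclideanSpace ℝ (Fin d), Function.Injective P →
          ∃ (t : ℕ) (s : RealRAM.State) (h : AffineSubspace ℝ (EuclideanSpace ℝ (Fin d))),
            RealRAM.Exec A (RealRAM.input P) t s ∧
            t ≤ C * (d + k) ^ e ∧
            RealRAM.Outputs s h ∧
            IsHyperplane h ∧
            (3 ≤ k →
              c * ((maxOnHyperplane (Set.range P) : ℝ) * Real.log k /
                (k * Real.log (Real.log k))) ≤ (numOn (Set.range P) h : ℝ)) := by
  obtain ⟨C, e, hcost⟩ := RealRAM.approxHyperplane.exists_cost_le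
  refine ⟨RealRAM.approxHyperplane, C * 2 ^ e, e, Real.log (Real.log 3) / 2,
    half_pos log_log_three_pos, fun d k hd P hP => ?_⟩
  obtain ⟨t, s, hexec, ht, start, nb, sub, hinv⟩ :=
    RealRAM.runs_approxHyperplane hd P le_rfl
  obtain ⟨h, hout, hh, hbest⟩ := exists_isHyperplane_of_isWitness hP hinv.witness
  refine ⟨t, s, h, hexec, ?_, hout, hh, fun hk => ?_⟩
  · calc t ≤ C * (d + k + 1) ^ e := ht.trans (hcost _ (by omega))
      _ ≤ C * (2 * (d + k)) ^ e := by gcongr; omega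
      _ = C * 2 ^ e * (d + k) ^ e := by rw [mul_pow, mul_assoc]
  · have hopt : maxOnHyperplane (Set.range P) ≤ (nb + 1) * s.ivar 8 :=
      maxOnHyperplane_le fun h' hh' => by
        obtain ⟨x, hx, hle⟩ := exists_numOn_le_orthCount P hh'
        exact hle.trans (hinv.orthCount_range_le hx)
    have hstart : (start : ℝ) ≤ k := by exact_mod_cast hinv.start_le
    exact (ratio_le hk (hinv.blocks.trans hstart) hopt).trans (by exact_mod_cast hbest)
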